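/- **Setting.** Let $\mathcal X$ (single-object states) be a locally compact, Hausdorff, second-countable space with its Borel $\sigma$-algebra and a $\sigma$-finite reference measure $dx$ without atoms. A trajectory up to time $k$ is $X=(t,x^{1:\nu})$ with $0\le t\le k$, $1\le\nu\le k-t+1$, $x^{1:\nu}\in\mathcal X^\nu$; $T_{(k)}$ is the space of these, with $\int\pi(X)\,dX=\sum_{(t,\nu)}\int\pi(t,x^{1:\nu})\,dx^{1:\nu}$. Set integrals are $\int f(\mathbf X)\,\delta\mathbf X=\sum_{n\ge0}\frac1{n!}\int f(\{X_1,\dots,X_n\})\,d(X_1,\dots,X_n)$, densities of random finite sets are taken with respect to this integral and identified if they agree almost everywhere, $\langle f,g\rangle=\int f(X)g(X)\,dX$, and $\uplus$ is disjoint union. Densities, intensities and weights are measurable where needed and take values in $[0,\infty]$, with $0/0=\infty/\infty=0\cdot\infty=0$. *PMBM form.* A PMBM density on finite sets of trajectories is $$f(\mathbf X)=\sum_{\mathbf Y\uplus\mathbf V=\mathbf X}e^{-\langle\lambda,1\rangle}\prod_{X\in\mathbf Y}\lambda(X)\;\sum_{a\in\mathcal A}w^a\sum_{\uplus_{i}\mathbf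 X^i=\mathbf V}\ \prod_{i=1}^{n}f^{i,a^i}(\mathbf X^i),$$ where $\langle\lambda,1\rangle<\infty$; the $i$-th of the $n$ Bernoulli components has $h^i$ local hypotheses $a^i$, each with a weight $w^{i,a^i}$, an existence probability $r^{i,a^i}\in[0,1]$, a single-trajectory density $f^{i,a^i}(X)$ and a set $\mathcal M^{i,a^i}\subseteq\mathcal M$ of pairs (time, measurement number); $f^{i,a^i}(\emptyset)=1-r^{i,a^i}$, $f^{i,a^i}(\{X\})=r^{i,a^i}f^{i,a^i}(X)$, and $f^{i,a^i}=0$ on larger sets; $\mathcal A$ is the set of $a=(a^1,\dots,a^n)$ with $\uplus_i\mathcal M^{i,a^i}=\mathcal M$; and $w^a=\prod_iw^{i,a^i}\big/\sum_{b\in\mathcal A}\prod_iw^{i,b^i}$, with denominator in $(0,\infty)$. (The requirement $\int f^{i,a^i}(X)\,dX=1$ is made only if $r^{i,a^i}\neq0$ and $0<w^{i,a^i}<\infty$.) *Two formulations.* Either only alive trajectories are considered ($t+\nu-1=k$; $\lambda$ and all $f^{i,a^i}$ vanish at other trajectories), or all trajectories ($t+\nu-1\le k$). *Measurement model.* A single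 object in state $x$ generates a finite set $\mathbf w\subset\mathbb R^{d}$ of measurements with an arbitrary set density $\ell_k(\mathbf w|x)$. Each trajectory $X$ independently generates a set of measurements with set density $\ell_k(\mathbf w|X)$, where $\ell_k(\mathbf w|t,x^{1:\nu})=\ell_k(\mathbf w|x^\nu)$ if $t+\nu-1=k$ (for trajectories that ended before $k$, $\ell_k(\cdot|X)$ may be any set density, e.g. that of no measurement). Independent clutter is a Poisson process with intensity $\lambda^C_k$, $\int\lambda_k^C(z)\,dz<\infty$. The union $\mathbf z_k$ thus has density $$f(\mathbf z_k|\mathbf X)=\sum_{\mathbf z^c\,\uplus\,\biguplus_{X\in\mathbf X}\mathbf w_X=\mathbf z_k}e^{-\int\lambda_k^C}\prod_{z\in\mathbf z^c}\lambda_k^C(z)\prod_{X\in\mathbf X}\ell_k(\mathbf w_X|X).$$ **Proposition.** In either formulation, let the predicted density $f_{k|k-1}$ be a PMBM with parameters $n_{k|k-1}$, $h^i_{k|k-1}$, $\lambda_{k|k-1}$, $w^{i,a}_{k|k-1}$, $r^{i,a}_{k|k-1}$, $f^{i,a}_{k|k-1}$, $\mathcal M^{i,a}_{k-1}\subseteq\mathcal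 M_{k-1}$, all pairs in $\mathcal M_{k-1}$ having time index smaller than $k$. Let $\mathbf z_k=\{z_k^1,\dots,z_k^{m_k}\}$ ($m_k$ distinct elements) satisfy $0<\int f(\mathbf z_k|\mathbf X)f_{k|k-1}(\mathbf X)\,\delta\mathbf X<\infty$. Then the posterior density $$f_{k|k}(\mathbf X)=\frac{f(\mathbf z_k|\mathbf X)f_{k|k-1}(\mathbf X)}{\int f(\mathbf z_k|\mathbf X')f_{k|k-1}(\mathbf X')\,\delta\mathbf X'}$$ is a PMBM in the same formulation, with $n_{k|k}=n_{k|k-1}+m_k$, $\mathcal M_k=\mathcal M_{k-1}\cup\{(k,j):1\le j\le m_k\}$, $\lambda_{k|k}(X)=\ell_k(\emptyset|X)\lambda_{k|k-1}(X)$, and the following local hypotheses. 1. *Continuing components* $i\le n_{k|k-1}$: one local hypothesis for each pair $(a,\mathbf w)$ of a previous local hypothesis $a$ and a subset $\mathbf w\subseteq\mathbf z_k$, so $h^i_{k|k}=2^{m_k}h^i_{k|k-1}$. Write $\ell^{i,a,\mathbf w}=\langle f^{i,a}_{k|k-1},\ell_k(\mathbf w|\cdot)\rangle$. In all cases its set of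 pairs is $\mathcal M_{k-1}^{i,a}\cup\{(k,p):z_k^p\in\mathbf w\}$ and its density is $\ell_k(\mathbf w|X)f^{i,a}_{k|k-1}(X)/\ell^{i,a,\mathbf w}$. If $\mathbf w=\emptyset$, its weight is $w^{i,a}_{k|k-1}(1-r^{i,a}_{k|k-1}+r^{i,a}_{k|k-1}\ell^{i,a,\emptyset})$ and its existence probability is $r^{i,a}_{k|k-1}\ell^{i,a,\emptyset}/(1-r^{i,a}_{k|k-1}+r^{i,a}_{k|k-1}\ell^{i,a,\emptyset})$. If $\mathbf w\ne\emptyset$, they are $w^{i,a}_{k|k-1}r^{i,a}_{k|k-1}\ell^{i,a,\mathbf w}$ and $1$. 2. *New components* $i=n_{k|k-1}+j$, $j\in\{1,\dots,m_k\}$, one per measurement. Let $\mathcal S_j=\{\{z_k^j\}\}\cup\{\{z_k^j\}\cup\mathbf w:\mathbf w\in\bigcup_{q<j}\mathcal S_q\}$; it consists of $2^{j-1}$ non-empty sets. There are $h^i_{k|k}=2^{j-1}+1$ local hypotheses: non-existence, with empty set of pairs, weight $1$ and existence probability $0$; and, for each $\mathbf w\in\mathcal S_j$, one with set of pairs $\{(k,p):z_k^p\in\mathbf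 w\}$ and, writing $\ell^{\mathbf w}=\langle\lambda_{k|k-1},\ell_k(\mathbf w|\cdot)\rangle$, $$w=\delta_1[|\mathbf w|]\prod_{z\in\mathbf w}\lambda_k^C(z)+\ell^{\mathbf w},\qquad r=\frac{\ell^{\mathbf w}}{w},\qquad f(X)=\frac{\ell_k(\mathbf w|X)\lambda_{k|k-1}(X)}{\ell^{\mathbf w}}.$$ -/

import Mathlib

open MeasureTheory
open scoped ENNReal

noncomputable section

namespace TrajPMBM

/-! ### Finite sets, set integrals, Poisson processes -/

section Generic

variable {T : Type*}

open scoped Classical in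
/-- The finite set `{x₁, …, xₙ}` of the entries of a tuple. -/
def tupleSet {n : ℕ} (x : Fin n → T) : Finset T := Finset.univ.image x

/-- The set integral `∫ f(X) δX = ∑ₙ (1/n!) ∫ f({x₁, …, xₙ}) d(x₁, …, xₙ)` with respect to the
reference measure `ν` on the single-element space. -/
def setIntegral [MeasurableSpace T] (ν : Measure T) (f : Finset T → ℝ≥0∞) : ℝ≥0∞ :=
  ∑' n : ℕ, ((n.factorial : ℝ≥0∞))⁻¹ *
    ∫⁻ x : Fin n → T, f (tupleSet x) ∂(Measure.pi fun _ => ν)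

/-- Equality of two functions of a finite set, almost everywhere with respect to the
reference measure underlying the set integral. -/
def SetAEEq [MeasurableSpace T] (ν : Measure T) (f g : Finset T → ℝ≥0∞) : Prop :=
  ∀ n : ℕ, ∀ᵐ x : Fin n → T ∂(Measure.pi fun _ => ν), f (tupleSet x) = g (tupleSet x)

open scoped Classical in
/-- All families `(Aᵢ)` of mutually disjoint (possibly empty) sets with `⊎ᵢ Aᵢ = A`. -/
def splits (ι : Type*) [Fintype ι] (A : Finset T) : Finset (ι → Finset T) :=
  (Fintype.piFinset fun _ : ι => A.powerset).filter fun S =>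
    (∀ i j, i ≠ j → Disjoint (S i) (S j)) ∧ Finset.univ.biUnion S = A

/-- The density `e^{-⟨lam, 1⟩} ∏_{x ∈ Y} lam(x)` of a Poisson point process with intensity `lam`. -/
def ppp [MeasurableSpace T] (ν : Measure T) (lam : T → ℝ≥0∞) (Y : Finset T) : ℝ≥0∞ :=
  ENNReal.ofReal (Real.exp (-(∫⁻ x, lam x ∂ν).toReal)) * ∏ x ∈ Y, lam x

open scoped Classical in
/-- The Bernoulli density with existence probability `r` and single-element density `f`:
`1 - r` at `∅`, `r f(x)` at `{x}`, and `0` at larger sets. -/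
def bernoulli (r : ℝ≥0∞) (f : T → ℝ≥0∞) (X : Finset T) : ℝ≥0∞ :=
  if X = ∅ then 1 - r else if X.card = 1 then r * ∏ x ∈ X, f x else 0

/-- `L(w | x)` is, for each `x`, a density of a random finite set `w` in `Z`
(with reference measure `ν` on `Z`), jointly measurable in `w` and `x`. -/
structure IsSetDensityKernel {Z : Type*} [MeasurableSpace Z] [MeasurableSpace T] (ν : Measure Z)
    (L : Finset Z → T → ℝ≥0∞) : Prop where
  measurable : ∀ n : ℕ, Measurable fun p : (Fin n → Z) × T => L (tupleSet p.1) p.2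
  integral_eq_one : ∀ x, setIntegral ν (fun w => L w x) = 1

/-- The multi-object likelihood `f(z | X)`: the density of the union of a Poisson set of clutter
with intensity `lamC` and independent sets of measurements with density `L(· | x)`, one for each
`x ∈ X`. -/
def multiLikelihood {Z : Type*} [MeasurableSpace Z] (ν : Measure Z) (lamC : Z → ℝ≥0∞)
    (L : Finset Z → T → ℝ≥0∞) (z : Finset Z) (X : Finset T) : ℝ≥0∞ :=
  ∑ S ∈ splits (Option X) z, ppp ν lamC (S none) * ∏ x : X, L (S (some x)) x

/-- The normalising constant `∫ lik(X) f(X) δX` of Bayes' rule. -/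
def evidence [MeasurableSpace T] (ν : Measure T) (lik f : Finset T → ℝ≥0∞) : ℝ≥0∞ :=
  setIntegral ν fun X => lik X * f X

/-- The posterior density given by Bayes' rule. -/
def posterior [MeasurableSpace T] (ν : Measure T) (lik f : Finset T → ℝ≥0∞) (X : Finset T) :
    ℝ≥0∞ :=
  lik X * f X / evidence ν lik f

end Generic

/-! ### The PMBM form -/

/-- The parameters of a Poisson multi-Bernoulli mixture on finite subsets of `T`, with
measurement-association bookkeeping. -/
structure PMBM (T : Type*) where
  /-- the Bernoulli components -/
  Comp : Type
  [fintypeComp : Fintype Comp]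
  /-- the local hypotheses of each component -/
  Hyp : Comp → Type
  [fintypeHyp : ∀ i, Fintype (Hyp i)]
  /-- intensity of the Poisson part -/
  lam : T → ℝ≥0∞
  /-- weights of the local hypotheses -/
  w : (i : Comp) → Hyp i → ℝ≥0∞
  /-- existence probabilities -/
  r : (i : Comp) → Hyp i → ℝ≥0∞
  /-- single-element densities -/
  f : (i : Comp) → Hyp i → T → ℝ≥0∞
  /-- the pairs (time, measurement number) associated to a local hypothesis -/
  assoc : (i : Comp) → Hyp i → Finset (ℕ × ℕ)
  /-- all pairs (time, measurement number) received so far -/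
  meas : Finset (ℕ × ℕ)

attribute [instance] PMBM.fintypeComp PMBM.fintypeHyp

namespace PMBM

variable {T : Type*} (P : PMBM T)

open scoped Classical in
/-- The global hypotheses: one local hypothesis per component, whose associated
measurements form a disjoint union equal to the set of all measurements. -/
def globalHyps : Finset ((i : P.Comp) → P.Hyp i) :=
  Finset.univ.filter fun a =>
    (∀ i j, i ≠ j → Disjoint (P.assoc i (a i)) (P.assoc j (a j))) ∧
      Finset.univ.biUnion (fun i => P.assoc i (a i)) = P.meas

/-- The sum over all global hypotheses of the products of their local weights. -/
def totalWeight : ℝ≥0∞ := ∑ a ∈ P.globalHyps, ∏ i, P.w i (a i)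

/-- The normalised weight of a global hypothesis. -/
def globalWeight (a : (i : P.Comp) → P.Hyp i) : ℝ≥0∞ := (∏ i, P.w i (a i)) / P.totalWeight

/-- The multi-Bernoulli mixture density. -/
def mbm (V : Finset T) : ℝ≥0∞ :=
  ∑ a ∈ P.globalHyps, P.globalWeight a *
    ∑ S ∈ splits P.Comp V, ∏ i, bernoulli (P.r i (a i)) (P.f i (a i)) (S i)

open scoped Classical in
/-- The PMBM density `∑_{Y ⊎ V = X} fᵖ(Y) fᵐᵇᵐ(V)`. -/
def density [MeasurableSpace T] (ν : Measure T) (X : Finset T) : ℝ≥0∞ :=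
  ∑ Y ∈ X.powerset, ppp ν P.lam Y * P.mbm (X \ Y)

/-- Well-formedness of the parameters of a PMBM whose elements lie in `D` and whose measurements
were all received before time `K`.  The single-element density of a local hypothesis is immaterial
if the hypothesis cannot exist (`r = 0`) or cannot be part of a global hypothesis of non-zero
weight (`w = 0`, or `w = ∞`, since the total weight is finite). -/
structure Valid [MeasurableSpace T] (ν : Measure T) (D : Set T) (K : ℕ) : Prop where
  lam_measurable : Measurable P.lam
  lam_integral : ∫⁻ x, P.lam x ∂ν ≠ ∞
  lam_support : ∀ x, x ∉ D → P.lam x = 0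
  r_le_one : ∀ i a, P.r i a ≤ 1
  f_measurable : ∀ i a, Measurable (P.f i a)
  f_support : ∀ i a x, x ∉ D → P.f i a x = 0
  f_integral : ∀ i a, P.w i a ≠ 0 → P.w i a ≠ ∞ → P.r i a ≠ 0 → ∫⁻ x, P.f i a x ∂ν = 1
  totalWeight_ne_zero : P.totalWeight ≠ 0
  totalWeight_ne_top : P.totalWeight ≠ ∞
  assoc_subset : ∀ i a, P.assoc i a ⊆ P.meas
  meas_time : ∀ p ∈ P.meas, p.1 < K

/-- `g` is a PMBM density with the (well-formed) parameters `P`. -/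
def Represents [MeasurableSpace T] (ν : Measure T) (D : Set T) (K : ℕ) (g : Finset T → ℝ≥0∞) :
    Prop :=
  P.Valid ν D K ∧ SetAEEq ν g (P.density ν)

end PMBM

/-! ### The update -/

/-- The sets (of measurement numbers) that create the local hypotheses of the `i`-th new
component: `S i = {{i}} ∪ {{i} ∪ w | w ∈ ⋃_{j < i} S j}`. -/
def newSets {m : ℕ} (i : Fin m) : Finset (Finset (Fin m)) :=
  insert {i} (((Finset.univ.filter (· < i)).attach.biUnion fun j => newSets j.1).image (insert i))
termination_by i.val
decreasing_by
  have := j.2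
  simp only [Finset.mem_filter] at this
  exact this.2

namespace PMBM

variable {T : Type*} (P : PMBM T)

/-- Local hypotheses after the update with `m` measurements.  Continuing component: a previous local
hypothesis and the set of numbers of the newly associated measurements (empty for a misdetection).
`j`-th new component: `none` for non-existence, or a set in `newSets j`. -/
def UpdHyp (m : ℕ) : P.Comp ⊕ Fin m → Type
  | .inl i => P.Hyp i × Finset (Fin m)
  | .inr j => Option {s : Finset (Fin m) // s ∈ newSets j}

instance (m : ℕ) : ∀ i, Fintype (P.UpdHyp m i)
  | .inl i => inferInstanceAs (Fintype (P.Hyp i × Finset (Fin m)))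
  | .inr j => inferInstanceAs (Fintype (Option {s : Finset (Fin m) // s ∈ newSets j}))

/-- The pairs `(k, p)` for the measurements (numbered from 1) of time `k` in `s`. -/
def pairs {m : ℕ} (k : ℕ) (s : Finset (Fin m)) : Finset (ℕ × ℕ) :=
  s.image fun p : Fin m => (k, (p : ℕ) + 1)

variable [MeasurableSpace T] (ν : Measure T) {Z : Type*} (lamC : Z → ℝ≥0∞)
  (L : Finset Z → T → ℝ≥0∞) {m : ℕ} (z : Fin m ↪ Z)

/-- `⟨f^{i,a}, L(w | ·)⟩`, where `w` is the set of the measurements with number in `s`. -/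
def detLik (i : P.Comp) (a : P.Hyp i) (s : Finset (Fin m)) : ℝ≥0∞ :=
  ∫⁻ x, P.f i a x * L (s.map z) x ∂ν

/-- `⟨lam, L(w | ·)⟩`, where `w` is the set of the measurements with number in `s`. -/
def newLik (s : Finset (Fin m)) : ℝ≥0∞ :=
  ∫⁻ x, P.lam x * L (s.map z) x ∂ν

/-- Weight of the local hypothesis of a new component created by `s`. -/
def newWeight (s : Finset (Fin m)) : ℝ≥0∞ :=
  (if s.card = 1 then ∏ y ∈ s.map z, lamC y else 0) + P.newLik ν L z s

/-- The updated parameters, given the measurements `z` of time `k`, the clutter intensity `lamC` and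
the single-element measurement density `L`. -/
def update (k : ℕ) : PMBM T where
  Comp := P.Comp ⊕ Fin m
  Hyp := P.UpdHyp m
  lam := fun x => L ∅ x * P.lam x
  w
    | .inl i => fun (a, s) =>
        if s = ∅ then P.w i a * (1 - P.r i a + P.r i a * P.detLik ν L z i a ∅)
        else P.w i a * P.r i a * P.detLik ν L z i a s
    | .inr _ => fun
        | none => 1
        | some s => P.newWeight ν lamC L z s.1
  r
    | .inl i => fun (a, s) =>
        if s = ∅ then P.r i a * P.detLik ν L z i a ∅ /
          (1 - P.r i a + P.r i a * P.detLik ν L z i a ∅)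
        else 1
    | .inr _ => fun
        | none => 0
        | some s => P.newLik ν L z s.1 / P.newWeight ν lamC L z s.1
  f
    | .inl i => fun (a, s) x => L (s.map z) x * P.f i a x / P.detLik ν L z i a s
    | .inr _ => fun
        | none => fun _ => 0
        | some s => fun x => L (s.1.map z) x * P.lam x / P.newLik ν L z s.1
  assoc
    | .inl i => fun (a, s) => P.assoc i a ∪ pairs k s
    | .inr _ => fun
        | none => ∅
        | some s => pairs k s.1
  meas := P.meas ∪ pairs k (Finset.univ : Finset (Fin m))

end PMBM

/-! ### Trajectories -/

/-- The pairs (start time `t`, length `ν`) with `0 ≤ t ≤ k` and `1 ≤ ν ≤ k - t + 1`. -/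
abbrev TrajIdx (k : ℕ) : Type := {p : ℕ × ℕ // p.1 ≤ k ∧ 1 ≤ p.2 ∧ p.1 + p.2 ≤ k + 1}

/-- The single-trajectory space up to time `k`: start time, length, and the state sequence. -/
abbrev Traj (𝒳 : Type*) (k : ℕ) : Type _ := Σ p : TrajIdx k, (Fin p.1.2 → 𝒳)

/-- The reference measure on trajectories, `∫ π(X) dX = ∑_{(t,ν)} ∫ π(t, x^{1:ν}) dx^{1:ν}`. -/
def trajMeasure {𝒳 : Type*} [MeasurableSpace 𝒳] (μ : Measure 𝒳) (k : ℕ) : Measure (Traj 𝒳 k) :=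
  Measure.sum fun p : TrajIdx k =>
    (Measure.pi fun _ : Fin p.1.2 => μ).map fun x => (⟨p, x⟩ : Traj 𝒳 k)

/-- The final state of a trajectory. -/
def Traj.last {𝒳 : Type*} {k : ℕ} (X : Traj 𝒳 k) : 𝒳 :=
  X.2 ⟨X.1.1.2 - 1, Nat.sub_lt X.1.2.2.1 Nat.one_pos⟩

/-- The trajectories that are alive at time `k`, i.e. `t + ν - 1 = k`. -/
def aliveTraj (𝒳 : Type*) (k : ℕ) : Set (Traj 𝒳 k) := {X | X.1.1.1 + X.1.1.2 = k + 1}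

/-- The two problem formulations. -/
inductive Formulation
  | alive
  | all

/-- The trajectories considered in a problem formulation. -/
def Formulation.domain (𝒳 : Type*) (k : ℕ) : Formulation → Set (Traj 𝒳 k)
  | .alive => aliveTraj 𝒳 k
  | .all => Set.univ

end TrajPMBM

end

open TrajPMBM

/-!
The proof works with generating functions.  Functions of a finite set form a commutative semiring
`SetAlg` under the convolution `(F * G)(X) = ∑_{Y ⊎ W = X} F(Y) G(W)`; these are polynomials in
commuting indeterminates of square zero, and a sum over splittings of `X` is a coefficient of a
product (`SetAlg.prod_apply`).  A Poisson density is an exponential `expo`, which turns sums into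
products (`expo_add`), and a Bernoulli density is an `atMostOne`.

Let the elements of `T` and the `m` measurements be indeterminates.  Multiplying the prior by the
likelihood replaces each indeterminate `x` by `x` times the generating function of the measurements
of `x`; this substitution `attach` is a ring homomorphism, so each factor of the prior is updated
separately.  A Bernoulli factor becomes a sum over the sets of measurements it may produce
(`attach_atMostOne`).  The Poisson factor becomes the exponential of the intensity of undetected
elements times, for each `j`, the exponential of the part in which the largest measurement number
is `j`.  All terms of that part are divisible by the indeterminate `j`, so its exponential stops
after the linear term, and together with the clutter factor of `j` it is exactly the sum over the
local hypotheses of the `j`-th new component (`clutter_mul_attach_expo`).  Expanding the product and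
taking the coefficient of the product of all measurements leaves the sum over the global hypotheses
of the update (`PMBM.likelihood_mul_density`), an identity that holds for every finite set.

It remains to normalise.  As the reference measure has no atoms, almost all tuples have distinct
entries, and the set integral is multiplicative (`setIntegral_mul`).  Hence the unnormalised
contribution of each local hypothesis integrates to its weight, and the evidence is a finite
non-zero constant times the total weight of the update (`PMBM.evidence_eq`).  The weight of every
global hypothesis is therefore finite.  If it is zero, then one of its factors vanishes almost
everywhere; otherwise all its local weights lie in `(0, ∞)`, and each factor is almost everywhere
its weight times the stated Bernoulli density (`exists_ae_atMostOne_eq`).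
-/

noncomputable section

namespace TrajPMBM

/-! ### Convolution of set functions -/

/-- Functions of a finite subset of `V`, with the convolution product
`(F * G)(X) = ∑_{Y ⊎ W = X} F(Y) G(W)`: the generating functions in commuting indeterminates of
square zero, one for each element of `V`. -/
def SetAlg (V R : Type*) := Finset V → R

namespace SetAlg

section Basic

variable {V R : Type*}

@[ext] lemma ext {F G : SetAlg V R} (h : ∀ X, F X = G X) : F = G := funext h

/-- The pullback of a set function along an embedding. -/
def comap {U : Type*} (z : U ↪ V) (F : SetAlg V R) : SetAlg U R := fun X => F (X.map z)

lemma comap_apply {U : Type*} (z : U ↪ V) (F : SetAlg V R) (X : Finset U) :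
    comap z F X = F (X.map z) := rfl

variable [CommSemiring R]

instance : AddCommMonoid (SetAlg V R) := inferInstanceAs (AddCommMonoid (Finset V → R))

open scoped Classical in
/-- The set function with value `a` at `A`, and zero elsewhere. -/
def mono (A : Finset V) (a : R) : SetAlg V R := fun X => if X = A then a else 0

open scoped Classical in
instance : Mul (SetAlg V R) := ⟨fun F G X => ∑ Y ∈ X.powerset, F Y * G (X \ Y)⟩

instance : One (SetAlg V R) := ⟨mono ∅ 1⟩

@[simp] lemma zero_apply (X : Finset V) : (0 : SetAlg V R) X = 0 := rfl

@[simp] lemma add_apply (F G : SetAlg V R) (X : Finset V) : (F + G) X = F X + G X := rfl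

lemma mono_apply [DecidableEq V] (A : Finset V) (a : R) (X : Finset V) :
    mono A a X = if X = A then a else 0 := by
  rw [mono]
  congr

lemma one_apply [DecidableEq V] (X : Finset V) :
    (1 : SetAlg V R) X = if X = ∅ then 1 else 0 := mono_apply ∅ 1 X

lemma mul_apply [DecidableEq V] (F G : SetAlg V R) (X : Finset V) :
    (F * G) X = ∑ Y ∈ X.powerset, F Y * G (X \ Y) := by
  refine Finset.sum_congr rfl fun Y _ => ?_
  congr!

lemma const_mul_apply (a : R) (F : SetAlg V R) (X : Finset V) :
    (mono ∅ a * F : SetAlg V R) X = a * F X := by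
  classical
  rw [mul_apply, Finset.sum_eq_single ∅]
  · simp [mono_apply]
  · intro Y _ hY
    simp [mono_apply, hY]
  · simp

protected lemma mul_comm' (F G : SetAlg V R) : F * G = G * F := by
  classical
  ext X
  rw [mul_apply, mul_apply]
  refine Finset.sum_nbij' (fun Y => X \ Y) (fun Y => X \ Y) ?_ ?_ ?_ ?_ ?_
  · simp
  · simp
  · intro Y hY
    simpa using hY
  · intro Y hY
    simpa using hY
  · intro Y hY
    rw [Finset.sdiff_sdiff_eq_self (Finset.mem_powerset.1 hY), mul_comm]

protected lemma mul_assoc' (F G H : SetAlg V R) : F * G * H = F * (G * H) := by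
  classical
  ext X
  simp only [mul_apply, Finset.sum_mul, Finset.mul_sum]
  rw [Finset.sum_sigma', Finset.sum_sigma']
  refine Finset.sum_nbij' (fun p => ⟨p.2, p.1 \ p.2⟩) (fun p => ⟨p.1 ∪ p.2, p.1⟩) ?_ ?_ ?_ ?_ ?_
  · rintro ⟨Y, W⟩ h
    simp only [Finset.mem_sigma, Finset.mem_powerset] at h ⊢
    grind
  · rintro ⟨Y, W⟩ h
    simp only [Finset.mem_sigma, Finset.mem_powerset] at h ⊢
    grind
  · rintro ⟨Y, W⟩ h
    simp only [Finset.mem_sigma, Finset.mem_powerset] at h ⊢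
    simp [h.2]
  · rintro ⟨Y, W⟩ h
    simp only [Finset.mem_sigma, Finset.mem_powerset] at h ⊢
    have : (Y ∪ W) \ Y = W := by grind
    simp [this]
  · rintro ⟨Y, W⟩ h
    simp only [Finset.mem_sigma, Finset.mem_powerset] at h ⊢
    have : (X \ W) \ (Y \ W) = X \ Y := by grind
    rw [this, mul_assoc]

instance : CommSemiring (SetAlg V R) where
  mul_assoc := SetAlg.mul_assoc'
  mul_comm := SetAlg.mul_comm'
  one_mul F := by
    ext X
    exact (const_mul_apply 1 F X).trans (one_mul _)
  mul_one F := by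
    ext X
    rw [SetAlg.mul_comm']
    exact (const_mul_apply 1 F X).trans (one_mul _)
  zero_mul F := by classical ext X; simp [mul_apply]
  mul_zero F := by classical ext X; simp [mul_apply]
  left_distrib F G H := by classical ext X; simp [mul_apply, mul_add, Finset.sum_add_distrib]
  right_distrib F G H := by classical ext X; simp [mul_apply, add_mul, Finset.sum_add_distrib]

@[simp] lemma sum_apply {ι : Type*} (s : Finset ι) (F : ι → SetAlg V R) (X : Finset V) :
    (∑ i ∈ s, F i) X = ∑ i ∈ s, F i X :=
  Finset.sum_apply X s F

lemma mono_mul_mono [DecidableEq V] (A B : Finset V) (a b : R) :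
    mono A a * mono B b = if Disjoint A B then mono (A ∪ B) (a * b) else 0 := by
  ext X
  rw [mul_apply]
  by_cases hA : A ⊆ X
  · rw [Finset.sum_eq_single A]
    · by_cases hB : X \ A = B
      · have h1 : Disjoint A B := hB ▸ Finset.disjoint_sdiff
        have h2 : X = A ∪ B := by rw [← hB, Finset.union_sdiff_of_subset hA]
        rw [hB, if_pos h1, mono_apply, mono_apply, mono_apply, if_pos rfl, if_pos rfl, if_pos h2]
      · have : ¬ (Disjoint A B ∧ X = A ∪ B) := by
          rintro ⟨h1, h2⟩
          exact hB (by rw [h2, Finset.union_sdiff_cancel_left h1])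
        by_cases h1 : Disjoint A B
        · have h2 : X ≠ A ∪ B := fun h => this ⟨h1, h⟩
          simp [mono_apply, hB, h1, h2]
        · simp [mono_apply, hB, h1]
    · intro Y _ hY
      simp [mono_apply, hY]
    · intro h
      exact absurd (Finset.mem_powerset.2 hA) h
  · rw [Finset.sum_eq_zero]
    · have : X ≠ A ∪ B := by rintro rfl; exact hA Finset.subset_union_left
      split_ifs <;> simp [mono_apply, this]
    · intro Y hY
      have : Y ≠ A := by rintro rfl; exact hA (Finset.mem_powerset.1 hY)
      simp [mono_apply, this]

/-- The constants, as a ring homomorphism. -/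
def const : R →+* SetAlg V R where
  toFun := mono ∅
  map_one' := rfl
  map_mul' a b := by classical rw [mono_mul_mono]; simp
  map_zero' := by classical ext X; simp [mono_apply]
  map_add' a b := by classical ext X; by_cases h : X = ∅ <;> simp [mono_apply, h]

lemma const_apply [DecidableEq V] (a : R) (X : Finset V) :
    (const a : SetAlg V R) X = if X = ∅ then a else 0 := mono_apply ∅ a X

@[simp] lemma const_mul_apply' (a : R) (F : SetAlg V R) (X : Finset V) :
    (const a * F : SetAlg V R) X = a * F X := const_mul_apply a F X

lemma mul_congr {X : Finset V} {F F' G G' : SetAlg V R} (h : ∀ Y ⊆ X, F Y = F' Y)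
    (h' : ∀ Y ⊆ X, G Y = G' Y) : (F * G) X = (F' * G') X := by
  classical
  rw [mul_apply, mul_apply]
  refine Finset.sum_congr rfl fun Y hY => ?_
  rw [h Y (Finset.mem_powerset.1 hY), h' _ Finset.sdiff_subset]

/-- A value of a product depends only on the values of the factors at smaller sets. -/
lemma prod_congr {ι : Type*} (s : Finset ι) {X : Finset V} {F G : ι → SetAlg V R}
    (h : ∀ i ∈ s, ∀ Y ⊆ X, F i Y = G i Y) : ∀ Y ⊆ X, (∏ i ∈ s, F i) Y = (∏ i ∈ s, G i) Y := by
  classical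
  induction s using Finset.induction_on with
  | empty => simp
  | insert i s hi ih =>
    intro Y hY
    rw [Finset.prod_insert hi, Finset.prod_insert hi]
    refine mul_congr (fun W hW => h i (by simp) W (hW.trans hY)) fun W hW => ?_
    exact ih (fun j hj => h j (by simp [hj])) W (hW.trans hY)

open scoped Classical in
/-- If `e(s, a) e(t, b)` is `e(s ∪ t, ab)` for disjoint `s` and `t` and vanishes otherwise, then the
same rule holds for products of any length. -/
lemma prod_of_disjoint_mul {ι U B M : Type*} [DecidableEq U] [CommSemiring B] [CommSemiring M]
    (e : Finset U → B → M) (h1 : e ∅ 1 = 1)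
    (hmul : ∀ s t a b, e s a * e t b = if Disjoint s t then e (s ∪ t) (a * b) else 0)
    (I : Finset ι) (S : ι → Finset U) (F : ι → B) :
    ∏ i ∈ I, e (S i) (F i) =
      if ∀ i ∈ I, ∀ j ∈ I, i ≠ j → Disjoint (S i) (S j) then e (I.biUnion S) (∏ i ∈ I, F i)
      else 0 := by
  induction I using Finset.induction_on with
  | empty => simp [h1]
  | insert i I hi ih =>
    rw [Finset.prod_insert hi, ih, mul_ite, mul_zero, hmul, Finset.biUnion_insert,
      Finset.prod_insert hi, ← ite_and]
    refine if_congr ?_ rfl rfl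
    rw [Finset.disjoint_biUnion_right]
    constructor
    · rintro ⟨h2, h3⟩ a ha b hb hab
      rcases Finset.mem_insert.1 ha with rfl | ha <;> rcases Finset.mem_insert.1 hb with rfl | hb
      · exact absurd rfl hab
      · exact h3 b hb
      · exact (h3 a ‹_›).symm
      · exact h2 a ha b hb hab
    · intro h
      exact ⟨fun a ha b hb hab => h a (by simp [ha]) b (by simp [hb]) hab,
        fun j hj => h i (by simp) j (by simp [hj]) (by rintro rfl; exact hi hj)⟩

/-- A product of set functions is the sum over all splittings of its argument. -/
lemma prod_apply {ι : Type*} [Fintype ι] (F : ι → SetAlg V R) (X : Finset V) :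
    (∏ i, F i) X = ∑ S ∈ splits ι X, ∏ i, F i (S i) := by
  classical
  have h1 : (∏ i, F i) X = (∏ i, ∑ Y ∈ X.powerset, mono Y (F i Y)) X := by
    refine prod_congr _ (fun i _ Y hY => ?_) X subset_rfl
    rw [sum_apply, Finset.sum_eq_single Y]
    · simp [mono_apply]
    · intro W _ hW
      rw [mono_apply, if_neg hW.symm]
    · intro h
      exact absurd (Finset.mem_powerset.2 hY) h
  rw [h1, Finset.prod_univ_sum, sum_apply, splits, Finset.sum_filter]
  refine Finset.sum_congr rfl fun S _ => ?_
  rw [prod_of_disjoint_mul mono rfl mono_mul_mono Finset.univ S fun i => F i (S i)]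
  simp only [Finset.mem_univ, true_implies, ite_and]
  split_ifs with h2 h3
  · rw [mono_apply, if_pos (by convert h3.symm)]
  · rw [mono_apply, if_neg (fun h => h3 (by convert h.symm))]
  · rfl

lemma comap_prod {U ι : Type*} (z : U ↪ V) (s : Finset ι) (F : ι → SetAlg V R) :
    comap z (∏ i ∈ s, F i) = ∏ i ∈ s, comap z (F i) := by
  classical
  induction s using Finset.induction_on with
  | empty => ext X; simp [comap_apply, one_apply]
  | insert i s hi ih =>
    ext X
    rw [Finset.prod_insert hi, Finset.prod_insert hi, ← ih, comap_apply, mul_apply, mul_apply]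
    refine (Finset.sum_nbij (fun Y => Y.map z) ?_ ?_ ?_ ?_).symm
    · intro Y hY
      simpa using hY
    · exact (Finset.map_injective z).injOn
    · intro Y hY
      obtain ⟨W, hW, rfl⟩ := Finset.subset_map_iff.1 (Finset.mem_powerset.1 hY)
      exact ⟨W, by simpa using hW, rfl⟩
    · intro Y _
      rw [comap_apply, comap_apply, Finset.map_sdiff]

end Basic

/-! ### Exponentials -/

section Expo

variable {V R : Type*} [CommSemiring R]

/-- The set function `X ↦ ∏_{x ∈ X} φ(x)`, the exponential of the set function that is `φ` on
singletons. -/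
def expo (φ : V → R) : SetAlg V R := fun X => ∏ x ∈ X, φ x

lemma expo_apply (φ : V → R) (X : Finset V) : expo φ X = ∏ x ∈ X, φ x := rfl

lemma expo_zero : expo (0 : V → R) = 1 := by
  classical
  ext X
  rw [expo_apply, one_apply]
  split_ifs with h
  · simp [h]
  · obtain ⟨x, hx⟩ := Finset.nonempty_iff_ne_empty.2 h
    exact Finset.prod_eq_zero hx rfl

lemma expo_add (φ ψ : V → R) : expo (φ + ψ) = expo φ * expo ψ := by
  classical
  ext X
  rw [mul_apply]
  exact Finset.prod_add φ ψ X

lemma expo_sum {ι : Type*} (s : Finset ι) (φ : ι → V → R) :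
    expo (∑ i ∈ s, φ i) = ∏ i ∈ s, expo (φ i) := by
  classical
  induction s using Finset.induction_on with
  | empty => simp [expo_zero]
  | insert i s hi ih => rw [Finset.sum_insert hi, Finset.prod_insert hi, expo_add, ih]

open scoped Classical in
/-- The set function with value `c` at `∅` and `φ(x)` at `{x}`, which vanishes at larger sets. -/
def atMostOne (c : R) (φ : V → R) : SetAlg V R :=
  fun X => if X = ∅ then c else if X.card = 1 then ∏ x ∈ X, φ x else 0

@[simp] lemma atMostOne_empty (c : R) (φ : V → R) : atMostOne c φ ∅ = c := by simp [atMostOne]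

@[simp] lemma atMostOne_singleton (c : R) (φ : V → R) (x : V) : atMostOne c φ {x} = φ x := by
  simp [atMostOne]

lemma atMostOne_of_one_lt (c : R) (φ : V → R) {X : Finset V} (h : 1 < X.card) :
    atMostOne c φ X = 0 := by
  have h1 : X ≠ ∅ := by rintro rfl; simp at h
  simp [atMostOne, h1, h.ne']

/-- A finite set is empty, a singleton, or has at least two elements. -/
lemma card_cases {motive : Finset V → Prop} (X : Finset V) (h0 : motive ∅)
    (h1 : ∀ x, X = {x} → motive {x}) (h2 : 1 < X.card → motive X) : motive X := by
  rcases lt_trichotomy X.card 1 with h | h | h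
  · have : X = ∅ := by simpa using h
    rwa [this]
  · obtain ⟨x, hx⟩ := Finset.card_eq_one.1 h
    rw [hx]
    exact h1 x hx
  · exact h2 h

lemma atMostOne_one_zero : atMostOne 1 (fun _ => 0) = (1 : SetAlg V R) := by
  classical
  ext X
  rw [one_apply]
  induction X using card_cases with
  | h0 => simp
  | h1 x _ => simp
  | h2 h =>
    have h0 : X ≠ ∅ := by rintro rfl; simp at h
    simp [atMostOne_of_one_lt _ _ h, h0]

/-- If the values of `φ` multiply to zero, then its exponential has no terms of higher order. -/
lemma expo_eq_atMostOne {φ : V → R} (h : ∀ x y, x ≠ y → φ x * φ y = 0) :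
    expo φ = atMostOne 1 φ := by
  classical
  ext X
  induction X using card_cases with
  | h0 => simp [expo_apply]
  | h1 x _ => simp [expo_apply]
  | h2 hX =>
    obtain ⟨x, hx, y, hy, hxy⟩ := Finset.one_lt_card.1 hX
    rw [atMostOne_of_one_lt _ _ hX, expo_apply, ← Finset.mul_prod_erase X φ hx,
      ← Finset.mul_prod_erase (X.erase x) φ (Finset.mem_erase.2 ⟨hxy.symm, hy⟩), ← mul_assoc,
      h x y hxy, zero_mul]

end Expo

end SetAlg

namespace SetAlg

/-! ### Joint generating functions of measurements and elements -/

section Joint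

variable {T U R : Type*} [CommSemiring R]

/-- The set function `F` times the monomial of the finite set `s` of measurements. -/
def joint (s : Finset U) (F : SetAlg T R) : SetAlg T (SetAlg U R) := fun X => mono s (F X)

lemma joint_apply (s : Finset U) (F : SetAlg T R) (X : Finset T) : joint s F X = mono s (F X) := rfl

lemma joint_mul [DecidableEq U] (s t : Finset U) (F G : SetAlg T R) :
    joint s F * joint t G = if Disjoint s t then joint (s ∪ t) (F * G) else 0 := by
  classical
  ext X : 1
  rw [mul_apply]
  simp only [joint_apply, mono_mul_mono]
  split_ifs with h
  · rw [joint_apply, mul_apply]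
    ext Y
    simp only [sum_apply, mono_apply]
    split_ifs <;> simp
  · simp

lemma joint_empty_one : joint (∅ : Finset U) (1 : SetAlg T R) = 1 := by
  classical
  ext X : 1
  rw [joint_apply, one_apply, one_apply]
  split_ifs
  · rfl
  · exact map_zero const

/-- The homomorphism that replaces each indeterminate `x ∈ T` by `x` times `lik x`, the generating
function of the measurements produced by `x`. -/
def attach (lik : T → SetAlg U R) : SetAlg T R →+* SetAlg T (SetAlg U R) where
  toFun F := fun X => const (F X) * ∏ x ∈ X, lik x
  map_one' := by
    classical
    ext X : 1
    rw [one_apply, one_apply]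
    split_ifs with h
    · simp [h]
    · simp
  map_zero' := by ext X : 1; simp
  map_add' F G := by
    ext X : 1
    change const (F X + G X) * _ = const (F X) * _ + const (G X) * _
    rw [map_add, add_mul]
  map_mul' F G := by
    classical
    ext X : 1
    simp only [mul_apply, map_sum, map_mul, Finset.sum_mul]
    refine Finset.sum_congr rfl fun Y hY => ?_
    rw [← Finset.prod_sdiff (Finset.mem_powerset.1 hY)]
    ring

lemma attach_apply (lik : T → SetAlg U R) (F : SetAlg T R) (X : Finset T) :
    attach lik F X = const (F X) * ∏ x ∈ X, lik x := rfl

/-- The expansion of a set function by monomials. -/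
lemma eq_sum_mono [Fintype U] (F : SetAlg U R) : F = ∑ s, mono s (F s) := by
  classical
  ext X
  rw [sum_apply, Finset.sum_eq_single X] <;> simp +contextual [mono_apply, eq_comm]

lemma attach_atMostOne [Fintype U] [DecidableEq U] (lik : T → SetAlg U R) (c : R) (φ : T → R) :
    attach lik (atMostOne c φ) =
      ∑ s, joint s (atMostOne (if s = ∅ then c else 0) fun x => φ x * lik x s) := by
  ext X : 1
  rw [attach_apply, sum_apply]
  simp only [joint_apply]
  induction X using card_cases with
  | h0 =>
    simp only [atMostOne_empty, Finset.prod_empty, mul_one]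
    ext Y
    rw [sum_apply, Finset.sum_eq_single Y]
    · simp [mono_apply, const_apply]
    · intro s _ hs
      simp [mono_apply, hs.symm]
    · simp
  | h1 x _ =>
    simp only [atMostOne_singleton, Finset.prod_singleton]
    rw [eq_sum_mono (const (φ x) * lik x)]
    simp
  | h2 h =>
    simp only [atMostOne_of_one_lt _ _ h, map_zero, zero_mul]
    exact (Finset.sum_eq_zero fun s _ => by ext; simp [mono_apply]).symm

end Joint

end SetAlg

open SetAlg

/-! ### The sets of measurements that create new components -/

lemma mem_newSets {m : ℕ} (j : Fin m) (s : Finset (Fin m)) :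
    s ∈ newSets j ↔ j ∈ s ∧ ∀ p ∈ s, p ≤ j := by
  induction j using WellFoundedLT.induction generalizing s with
  | ind j ih =>
    rw [newSets]
    simp only [Finset.mem_insert, Finset.mem_image, Finset.mem_biUnion, Finset.mem_attach,
      true_and, Subtype.exists, Finset.mem_filter, Finset.mem_univ]
    constructor
    · rintro (rfl | ⟨w, ⟨q, hq, hw⟩, rfl⟩)
      · simp
      · rw [ih q hq] at hw
        refine ⟨Finset.mem_insert_self _ _, fun p hp => ?_⟩
        rcases Finset.mem_insert.1 hp with rfl | hp
        · exact le_rfl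
        · exact (hw.2 p hp).trans hq.le
    · rintro ⟨hj, hle⟩
      by_cases h : (s.erase j).Nonempty
      · have hm := Finset.max'_mem _ h
        have hlt : (s.erase j).max' h < j :=
          lt_of_le_of_ne (hle _ (Finset.mem_of_mem_erase hm)) (Finset.ne_of_mem_erase hm)
        refine Or.inr ⟨s.erase j, ⟨_, hlt, (ih _ hlt _).2 ⟨hm, fun p hp => ?_⟩⟩,
          Finset.insert_erase hj⟩
        exact Finset.le_max' _ _ hp
      · left
        rw [Finset.not_nonempty_iff_eq_empty] at h
        rw [← Finset.insert_erase hj, h, insert_empty_eq]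

lemma card_newSets {m : ℕ} (j : Fin m) : (newSets j).card = 2 ^ (j : ℕ) := by
  have h : newSets j = (Finset.Iio j).powerset.image (insert j) := by
    ext s
    rw [mem_newSets, Finset.mem_image]
    constructor
    · rintro ⟨hj, hle⟩
      refine ⟨s.erase j, ?_, Finset.insert_erase hj⟩
      rw [Finset.mem_powerset]
      intro p hp
      rw [Finset.mem_Iio]
      exact lt_of_le_of_ne (hle p (Finset.mem_of_mem_erase hp)) (Finset.ne_of_mem_erase hp)
    · rintro ⟨w, hw, rfl⟩
      rw [Finset.mem_powerset] at hw
      refine ⟨Finset.mem_insert_self _ _, fun p hp => ?_⟩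
      rcases Finset.mem_insert.1 hp with rfl | hp
      · exact le_rfl
      · exact (Finset.mem_Iio.1 (hw hp)).le
  rw [h, Finset.card_image_of_injOn, Finset.card_powerset, Fin.card_Iio]
  intro s hs t ht hst
  have hj : ∀ w ∈ (Finset.Iio j).powerset, j ∉ w := fun w hw hjw => by
    simpa using Finset.mem_powerset.1 hw hjw
  rw [← Finset.erase_insert (hj s hs), ← Finset.erase_insert (hj t ht)]
  exact congrArg (fun w => w.erase j) hst

/-- Each non-empty set of measurements creates a local hypothesis of exactly one new component, that
of its last element. -/
lemma sum_finset_eq_newSets {m : ℕ} {M : Type*} [AddCommMonoid M] (f : Finset (Fin m) → M) :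
    ∑ s, f s = f ∅ + ∑ j : Fin m, ∑ s ∈ newSets j, f s := by
  rw [← Finset.add_sum_erase _ f (Finset.mem_univ ∅), ← Finset.sum_biUnion]
  · congr 2
    ext s
    simp only [Finset.mem_erase, Finset.mem_univ, and_true, Finset.mem_biUnion, true_and,
      mem_newSets]
    constructor
    · intro h
      have h' := Finset.nonempty_iff_ne_empty.2 h
      exact ⟨s.max' h', Finset.max'_mem _ _, fun p hp => Finset.le_max' _ _ hp⟩
    · rintro ⟨j, hj, _⟩ rfl
      simp at hj
  · intro i _ j _ hij
    refine Finset.disjoint_left.2 fun s hi hj => hij ?_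
    rw [mem_newSets] at hi hj
    exact le_antisymm (hj.2 i hi.1) (hi.2 j hj.1)

/-! ### The update of the Poisson part -/

section Poisson

variable {T R : Type*} [CommSemiring R] {m : ℕ}

/-- The generating function of a Poisson set is the product of those of its restrictions to
points. -/
lemma expo_eq_prod_points (γ : Fin m → R) : expo γ = ∏ j, (1 + mono {j} (γ j)) := by
  classical
  conv_lhs => rw [← Finset.univ_sum_single γ]
  rw [expo_sum]
  refine Finset.prod_congr rfl fun j _ => ?_
  rw [expo_eq_atMostOne]
  · ext X
    rw [SetAlg.add_apply]
    induction X using card_cases with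
    | h0 => simp [one_apply, mono_apply, eq_comm (a := (∅ : Finset (Fin m)))]
    | h1 x _ =>
      simp only [atMostOne_singleton, one_apply, mono_apply, Finset.singleton_ne_empty, if_false,
        zero_add, Finset.singleton_inj]
      by_cases h : x = j
      · subst h; simp
      · simp [h]
    | h2 h =>
      have h0 : X ≠ ∅ := by rintro rfl; simp at h
      have h1 : X ≠ {j} := by rintro rfl; simp at h
      simp [atMostOne_of_one_lt _ _ h, one_apply, mono_apply, h0, h1]
  · intro x y hxy
    by_cases h : x = j
    · have : y ≠ j := fun h' => hxy (h.trans h'.symm)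
      simp [this]
    · simp [h]

/-- The part of the product of the clutter generating function and the Poisson generating function
of elements in which the largest measurement of a set is `j`. -/
lemma clutter_mul_expo_newSets (γ : Fin m → R) (lam : T → R) (lik : T → SetAlg (Fin m) R)
    (j : Fin m) :
    const (1 + mono {j} (γ j)) *
        expo (fun x => ∑ s ∈ newSets j, mono s (lam x * lik x s)) =
      1 + ∑ s ∈ newSets j,
        joint s (atMostOne (if s.card = 1 then ∏ p ∈ s, γ p else 0) fun x => lam x * lik x s) := by
  classical
  have hzero : ∀ s ∈ newSets j, ∀ t ∈ newSets j, ∀ a b : R, mono s a * mono t b = 0 := by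
    intro s hs t ht a b
    rw [mono_mul_mono, if_neg]
    rw [mem_newSets] at hs ht
    exact fun h => Finset.disjoint_left.1 h hs.1 ht.1
  have hj : {j} ∈ newSets j := by simp [mem_newSets]
  rw [expo_eq_atMostOne]
  · ext X : 1
    rw [const_mul_apply', SetAlg.add_apply, SetAlg.sum_apply]
    simp only [joint_apply]
    induction X using card_cases with
    | h0 =>
      simp only [atMostOne_empty, mul_one]
      rw [Finset.sum_eq_single {j}]
      · simp [one_apply]
      · intro s hs hne
        rw [if_neg]
        · ext Y; simp [mono_apply]
        · intro hc
          obtain ⟨p, rfl⟩ := Finset.card_eq_one.1 hc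
          simp only [mem_newSets, Finset.mem_singleton] at hs
          exact hne (by rw [hs.1])
      · exact fun h => absurd hj h
    | h1 x _ =>
      simp only [atMostOne_singleton]
      rw [add_mul, one_mul, Finset.mul_sum, Finset.sum_eq_zero (s := newSets j)
        (f := fun s => mono {j} (γ j) * _) fun s hs => hzero _ hj _ hs _ _]
      simp [one_apply, add_comm]
    | h2 h =>
      have h0 : X ≠ ∅ := by rintro rfl; simp at h
      simp only [atMostOne_of_one_lt _ _ h, one_apply, h0, if_false, mul_zero, zero_add]
      exact (Finset.sum_eq_zero fun s _ => by ext; simp [mono_apply]).symm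
  · intro x y _
    rw [Finset.sum_mul_sum]
    exact Finset.sum_eq_zero fun s hs => Finset.sum_eq_zero fun t ht => hzero s hs t ht _ _

/-- The joint generating function of clutter, Poisson distributed elements and their measurements:
a Poisson process of undetected elements, and for each measurement `j` the sum over the sets of
measurements with largest element `j`. -/
lemma clutter_mul_attach_expo (γ : Fin m → R) (lam : T → R) (lik : T → SetAlg (Fin m) R) :
    const (expo γ) * attach lik (expo lam) =
      joint ∅ (expo fun x => lik x ∅ * lam x) *
        ∏ j, (1 + ∑ s ∈ newSets j,
          joint s (atMostOne (if s.card = 1 then ∏ p ∈ s, γ p else 0)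
            fun x => lam x * lik x s)) := by
  have h1 : attach lik (expo lam) = expo ((fun x => const (lik x ∅ * lam x)) +
      ∑ j, fun x => ∑ s ∈ newSets j, mono s (lam x * lik x s)) := by
    ext X : 1
    rw [attach_apply, expo_apply, expo_apply, map_prod, ← Finset.prod_mul_distrib]
    refine Finset.prod_congr rfl fun x _ => ?_
    rw [Pi.add_apply, Finset.sum_apply, eq_sum_mono (const (lam x) * lik x),
      sum_finset_eq_newSets]
    simp only [const_mul_apply', mul_comm (lik x ∅)]
    rfl
  have h2 : joint ∅ (expo fun x => lik x ∅ * lam x) =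
      expo (R := SetAlg (Fin m) R) fun x => const (lik x ∅ * lam x) := by
    ext X : 1
    rw [joint_apply, expo_apply, expo_apply, ← map_prod]
    rfl
  rw [h1, expo_add, expo_sum, expo_eq_prod_points, map_prod, h2, mul_left_comm,
    ← Finset.prod_mul_distrib]
  simp only [clutter_mul_expo_newSets]

end Poisson

/-! ### Likelihood and prior as set functions -/

section Likelihood

variable {T Z : Type*} [MeasurableSpace Z] (ν : Measure Z) (lamC : Z → ℝ≥0∞)
  (L : Finset Z → T → ℝ≥0∞) {U : Type*} (z : U ↪ Z)

/-- The factor `e^{-⟨lam, 1⟩}` of a Poisson density, its value at `∅`. -/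
def voidProb {T : Type*} [MeasurableSpace T] (ν : Measure T) (lam : T → ℝ≥0∞) : ℝ≥0∞ :=
  ENNReal.ofReal (Real.exp (-(∫⁻ x, lam x ∂ν).toReal))

lemma voidProb_ne_zero {T : Type*} [MeasurableSpace T] (ν : Measure T) (lam : T → ℝ≥0∞) :
    voidProb ν lam ≠ 0 := by
  simp [voidProb, Real.exp_pos]

lemma voidProb_ne_top {T : Type*} [MeasurableSpace T] (ν : Measure T) (lam : T → ℝ≥0∞) :
    voidProb ν lam ≠ ∞ :=
  ENNReal.ofReal_ne_top

lemma ppp_eq {T : Type*} [MeasurableSpace T] (ν : Measure T) (lam : T → ℝ≥0∞) (X : Finset T) :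
    ppp ν lam X = voidProb ν lam * expo lam X := rfl

/-- The generating function of the measurements produced by the element `x`. -/
def likGen (x : T) : SetAlg U ℝ≥0∞ := fun s => L (s.map z) x

/-- The multi-object likelihood is a coefficient of the product of the generating functions of
clutter and of the measurements of the elements. -/
lemma multiLikelihood_map (s : Finset U) (X : Finset T) :
    multiLikelihood ν lamC L (s.map z) X =
      voidProb ν lamC * (expo (fun p => lamC (z p)) * ∏ x ∈ X, likGen L z x) s := by
  let F : Option X → SetAlg Z ℝ≥0∞
    | none => const (voidProb ν lamC) * expo lamC
    | some x => fun w => L w x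
  have h1 : multiLikelihood ν lamC L (s.map z) X = comap z (∏ o, F o) s := by
    rw [comap_apply, SetAlg.prod_apply, multiLikelihood]
    refine Finset.sum_congr rfl fun S _ => ?_
    rw [Fintype.prod_option]
    simp only [F, const_mul_apply', ppp_eq]
  have h2 : comap z (F none) = const (voidProb ν lamC) * expo fun p => lamC (z p) := by
    ext Y
    simp only [F, comap_apply, const_mul_apply', expo_apply, Finset.prod_map]
  rw [h1, comap_prod, Fintype.prod_option, h2, mul_assoc, const_mul_apply',
    ← Finset.prod_coe_sort X]
  rfl

end Likelihood

namespace PMBM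

variable {T : Type*} (P : PMBM T)

/-- The Bernoulli set density of a local hypothesis, multiplied by its weight. -/
def priorTerm (i : P.Comp) (a : P.Hyp i) : SetAlg T ℝ≥0∞ :=
  atMostOne (P.w i a * (1 - P.r i a)) fun x => P.w i a * P.r i a * P.f i a x

lemma bernoulli_eq (r : ℝ≥0∞) (f : T → ℝ≥0∞) (X : Finset T) :
    bernoulli r f X = atMostOne (1 - r) (fun x => r * f x) X := by
  induction X using card_cases with
  | h0 => simp [bernoulli]
  | h1 x _ => simp [bernoulli]
  | h2 h =>
    have h0 : X ≠ ∅ := by rintro rfl; simp at h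
    simp [bernoulli, atMostOne_of_one_lt _ _ h, h0, h.ne']

lemma const_mul_atMostOne (a c : ℝ≥0∞) (φ : T → ℝ≥0∞) :
    const a * atMostOne c φ = atMostOne (a * c) fun x => a * φ x := by
  ext X
  rw [const_mul_apply']
  induction X using card_cases with
  | h0 => simp
  | h1 x _ => simp
  | h2 h => simp [atMostOne_of_one_lt _ _ h]

lemma density_eq_sum [MeasurableSpace T] (ν : Measure T) (X : Finset T) :
    P.density ν X = voidProb ν P.lam * ∑ a ∈ P.globalHyps, P.globalWeight a *
      (expo P.lam *
        ∏ i, atMostOne (1 - P.r i (a i)) fun x => P.r i (a i) * P.f i (a i) x) X := by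
  classical
  simp only [density, ppp_eq, mbm, SetAlg.mul_apply, SetAlg.prod_apply, Finset.mul_sum,
    bernoulli_eq]
  rw [Finset.sum_comm]
  refine Finset.sum_congr rfl fun a _ => Finset.sum_congr rfl fun Y _ => ?_
  refine Finset.sum_congr rfl fun S _ => ?_
  ring

lemma density_eq_priorTerm [MeasurableSpace T] (ν : Measure T) (X : Finset T) :
    P.density ν X = voidProb ν P.lam * P.totalWeight⁻¹ *
      (expo P.lam * ∑ a ∈ P.globalHyps, ∏ i, P.priorTerm i (a i)) X := by
  rw [density_eq_sum, Finset.mul_sum (a := expo P.lam), SetAlg.sum_apply, mul_assoc]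
  congr 1
  rw [Finset.mul_sum]
  refine Finset.sum_congr rfl fun a _ => ?_
  simp only [priorTerm, mul_assoc, ← const_mul_atMostOne, Finset.prod_mul_distrib, ← map_prod,
    globalWeight, div_eq_mul_inv]
  rw [mul_left_comm (expo P.lam), const_mul_apply']
  ring

/-! ### The unnormalised terms of the update -/

section Update

variable {Z : Type*} (lamC : Z → ℝ≥0∞) (L : Finset Z → T → ℝ≥0∞) {m : ℕ} (z : Fin m ↪ Z)

/-- The value at `∅` of the contribution of a local hypothesis of the update to the unnormalised
posterior. -/
def updVoid : (i : P.Comp ⊕ Fin m) → P.UpdHyp m i → ℝ≥0∞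
  | .inl i => fun h => if h.2 = ∅ then P.w i h.1 * (1 - P.r i h.1) else 0
  | .inr _ => fun
      | none => 1
      | some s => if s.1.card = 1 then ∏ y ∈ s.1.map z, lamC y else 0

/-- The values at singletons of the contribution of a local hypothesis of the update to the
unnormalised posterior. -/
def updDens : (i : P.Comp ⊕ Fin m) → P.UpdHyp m i → T → ℝ≥0∞
  | .inl i => fun h x => P.w i h.1 * P.r i h.1 * (P.f i h.1 x * L (h.2.map z) x)
  | .inr _ => fun
      | none => fun _ => 0
      | some s => fun x => P.lam x * L (s.1.map z) x

/-- The set function that a local hypothesis of the update contributes to the unnormalised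
posterior: weight times Bernoulli density, without any division. -/
def updTerm (i : P.Comp ⊕ Fin m) (h : P.UpdHyp m i) : SetAlg T ℝ≥0∞ :=
  atMostOne (P.updVoid lamC z i h) (P.updDens L z i h)

/-- The numbers of the measurements of the current time that are associated to a local hypothesis
of the update. -/
def nums : (i : P.Comp ⊕ Fin m) → P.UpdHyp m i → Finset (Fin m)
  | .inl _ => fun h => h.2
  | .inr _ => fun
      | none => ∅
      | some s => s.1

/-- The measurements of earlier times that are associated to a local hypothesis of the update. -/
def oldAssoc : (i : P.Comp ⊕ Fin m) → P.UpdHyp m i → Finset (ℕ × ℕ)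
  | .inl i => fun h => P.assoc i h.1
  | .inr _ => fun _ => ∅

/-- A choice of local hypotheses after the update consists of a choice before the update, the newly
associated measurements of each continuing component, and a choice for the new components. -/
def updHypEquiv (m : ℕ) : (∀ i, P.UpdHyp m i) ≃
    (∀ i, P.Hyp i) × (P.Comp → Finset (Fin m)) ×
      (∀ j : Fin m, Option {s : Finset (Fin m) // s ∈ newSets j}) where
  toFun a := (fun i => (a (.inl i)).1, fun i => (a (.inl i)).2, fun j => a (.inr j))
  invFun b := fun
    | .inl i => (b.1 i, b.2.1 i)
    | .inr j => b.2.2 j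
  left_inv a := by
    funext i
    cases i <;> rfl
  right_inv b := rfl

lemma mem_pairs {k : ℕ} {s : Finset (Fin m)} {p : ℕ × ℕ} :
    p ∈ pairs k s ↔ ∃ q ∈ s, (k, (q : ℕ) + 1) = p := by
  simp [pairs]

lemma mem_pairs_mk {k : ℕ} {s : Finset (Fin m)} {q : Fin m} :
    (k, (q : ℕ) + 1) ∈ pairs k s ↔ q ∈ s := by
  rw [mem_pairs]
  constructor
  · rintro ⟨q', hq', h⟩
    have : q' = q := Fin.ext (by simpa using h)
    rwa [← this]
  · exact fun h => ⟨q, h, rfl⟩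

open scoped Classical in
/-- Associations of earlier measurements and of current measurements do not interact, because the
pairs differ in the time index. -/
lemma disjoint_union_pairs_iff {I : Type*} [Fintype I] {k : ℕ} {M : Finset (ℕ × ℕ)}
    (hM : ∀ p ∈ M, p.1 < k) (A : I → Finset (ℕ × ℕ)) (hA : ∀ i, A i ⊆ M)
    (S : I → Finset (Fin m)) :
    ((∀ i j, i ≠ j → Disjoint (A i ∪ pairs k (S i)) (A j ∪ pairs k (S j))) ∧
        Finset.univ.biUnion (fun i => A i ∪ pairs k (S i)) =
          M ∪ pairs k (Finset.univ : Finset (Fin m))) ↔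
      ((∀ i j, i ≠ j → Disjoint (A i) (A j)) ∧ Finset.univ.biUnion A = M) ∧
        ((∀ i j, i ≠ j → Disjoint (S i) (S j)) ∧ Finset.univ.biUnion S = Finset.univ) := by
  have hM' : ∀ n, (k, n) ∉ M := fun n h => lt_irrefl _ (hM _ h)
  constructor
  · rintro ⟨h1, h2⟩
    refine ⟨⟨fun i j hij => (h1 i j hij).mono Finset.subset_union_left Finset.subset_union_left,
      ?_⟩, fun i j hij => ?_, ?_⟩
    · ext p
      constructor
      · intro hp
        obtain ⟨i, _, hi⟩ := Finset.mem_biUnion.1 hp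
        exact hA i hi
      · intro hp
        have h3 : p ∈ M ∪ pairs k (Finset.univ : Finset (Fin m)) := Finset.mem_union_left _ hp
        rw [← h2, Finset.mem_biUnion] at h3
        obtain ⟨i, _, hi⟩ := h3
        rcases Finset.mem_union.1 hi with hi | hi
        · exact Finset.mem_biUnion.2 ⟨i, Finset.mem_univ _, hi⟩
        · obtain ⟨q, _, rfl⟩ := mem_pairs.1 hi
          exact absurd hp (hM' _)
    · refine Finset.disjoint_left.2 fun q hi hj => ?_
      exact Finset.disjoint_left.1 (h1 i j hij) (Finset.mem_union_right _ (mem_pairs_mk.2 hi))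
        (Finset.mem_union_right _ (mem_pairs_mk.2 hj))
    · rw [Finset.eq_univ_iff_forall]
      intro q
      have h3 : (k, (q : ℕ) + 1) ∈ M ∪ pairs k (Finset.univ : Finset (Fin m)) :=
        Finset.mem_union_right _ (mem_pairs_mk.2 (Finset.mem_univ q))
      rw [← h2, Finset.mem_biUnion] at h3
      obtain ⟨i, _, hi⟩ := h3
      rcases Finset.mem_union.1 hi with hi | hi
      · exact absurd (hA i hi) (hM' _)
      · exact Finset.mem_biUnion.2 ⟨i, Finset.mem_univ _, mem_pairs_mk.1 hi⟩
  · rintro ⟨⟨h1, h2⟩, h3, h4⟩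
    refine ⟨fun i j hij => Finset.disjoint_left.2 fun p hi hj => ?_, ?_⟩
    · rcases Finset.mem_union.1 hi with hi | hi
      · rcases Finset.mem_union.1 hj with hj | hj
        · exact Finset.disjoint_left.1 (h1 i j hij) hi hj
        · obtain ⟨q, _, rfl⟩ := mem_pairs.1 hj
          exact hM' _ (hA i hi)
      · obtain ⟨q, hq, rfl⟩ := mem_pairs.1 hi
        rcases Finset.mem_union.1 hj with hj | hj
        · exact hM' _ (hA j hj)
        · exact Finset.disjoint_left.1 (h3 i j hij) hq (mem_pairs_mk.1 hj)
    · ext p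
      rw [← h2, Finset.mem_union, Finset.mem_biUnion, Finset.mem_biUnion]
      constructor
      · rintro ⟨i, _, hi⟩
        rcases Finset.mem_union.1 hi with hi | hi
        · exact Or.inl ⟨i, Finset.mem_univ _, hi⟩
        · obtain ⟨q, hq, rfl⟩ := mem_pairs.1 hi
          exact Or.inr (mem_pairs_mk.2 (Finset.mem_univ q))
      · rintro (⟨i, _, hi⟩ | h)
        · exact ⟨i, Finset.mem_univ _, Finset.mem_union_left _ hi⟩
        · obtain ⟨q, _, rfl⟩ := mem_pairs.1 h
          have hq := Finset.mem_univ q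
          rw [← h4, Finset.mem_biUnion] at hq
          obtain ⟨i, _, hi⟩ := hq
          exact ⟨i, Finset.mem_univ _, Finset.mem_union_right _ (mem_pairs_mk.2 hi)⟩

lemma update_assoc [MeasurableSpace T] (ν : Measure T) (k : ℕ) (i : P.Comp ⊕ Fin m)
    (h : P.UpdHyp m i) :
    (P.update ν lamC L z k).assoc i h = P.oldAssoc i h ∪ pairs k (P.nums i h) := by
  rcases i with i | j
  · rfl
  · rcases h with _ | s
    · simp [update, oldAssoc, nums, pairs]
    · simp [update, oldAssoc, nums]

lemma mem_globalHyps (a : ∀ i, P.Hyp i) :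
    a ∈ P.globalHyps ↔ (∀ i j, i ≠ j → Disjoint (P.assoc i (a i)) (P.assoc j (a j))) ∧
      ∀ p, p ∈ P.meas ↔ ∃ i, p ∈ P.assoc i (a i) := by
  classical
  rw [globalHyps, Finset.mem_filter]
  simp only [Finset.mem_univ, true_and, Finset.ext_iff, Finset.mem_biUnion]
  exact and_congr_right fun _ => forall_congr' fun p => iff_comm

open scoped Classical in
/-- The global hypotheses after the update: a global hypothesis before the update together with
a splitting of the current measurements among all components. -/
def updGlobalHyps (m : ℕ) : Finset (∀ i : P.Comp ⊕ Fin m, P.UpdHyp m i) :=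
  Finset.univ.filter fun a => (P.updHypEquiv m a).1 ∈ P.globalHyps ∧
    (∀ i j, i ≠ j → Disjoint (P.nums i (a i)) (P.nums j (a j))) ∧
      Finset.univ.biUnion (fun i => P.nums i (a i)) = Finset.univ

lemma mem_updGlobalHyps (a : ∀ i : P.Comp ⊕ Fin m, P.UpdHyp m i) :
    a ∈ P.updGlobalHyps m ↔ (P.updHypEquiv m a).1 ∈ P.globalHyps ∧
      (∀ i j, i ≠ j → Disjoint (P.nums i (a i)) (P.nums j (a j))) ∧
        Finset.univ.biUnion (fun i => P.nums i (a i)) = Finset.univ := by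
  simp [updGlobalHyps]

lemma globalHyps_update [MeasurableSpace T] (ν : Measure T) {k : ℕ}
    (hsub : ∀ i a, P.assoc i a ⊆ P.meas) (htime : ∀ p ∈ P.meas, p.1 < k) :
    (P.update ν lamC L z k).globalHyps = P.updGlobalHyps m := by
  classical
  refine Finset.ext fun a : ∀ i : P.Comp ⊕ Fin m, P.UpdHyp m i => ?_
  refine (mem_globalHyps _ _).trans ?_
  have h1 := disjoint_union_pairs_iff htime (fun i => P.oldAssoc i (a i))
    (by
      rintro (i | j)
      · exact hsub _ _
      · exact Finset.empty_subset _) fun i => P.nums i (a i)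
  have h2 : (Finset.univ.biUnion fun i => P.oldAssoc i (a i) ∪ pairs k (P.nums i (a i))) =
      P.meas ∪ pairs k (Finset.univ : Finset (Fin m)) ↔
        ∀ p, p ∈ P.meas ∪ pairs k (Finset.univ : Finset (Fin m)) ↔
          ∃ i, p ∈ P.oldAssoc i (a i) ∪ pairs k (P.nums i (a i)) := by
    rw [eq_comm, Finset.ext_iff]
    simp only [Finset.mem_biUnion, Finset.mem_univ, true_and]
  rw [h2] at h1
  simp only [← P.update_assoc lamC L z ν k] at h1
  refine h1.trans (Iff.trans ?_ (P.mem_updGlobalHyps a).symm)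
  refine and_congr_left fun _ => ?_
  rw [mem_globalHyps, eq_comm, Finset.ext_iff]
  refine and_congr ?_ (forall_congr' fun p => ?_)
  · constructor
    · exact fun h i j hij => h (.inl i) (.inl j) fun h' => hij (Sum.inl_injective h')
    · rintro h (i | i) (j | j) hij
      · exact h i j fun h' => hij (congrArg _ h')
      all_goals simp [oldAssoc]
  · simp only [Finset.mem_biUnion, Finset.mem_univ, true_and, Sum.exists, oldAssoc,
      Finset.notMem_empty, exists_false, or_false]
    rfl

/-- Splitting a continuing component according to the set of measurements it produces. -/
lemma attach_priorTerm (i : P.Comp) (a : P.Hyp i) :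
    attach (likGen L z) (P.priorTerm i a) =
      ∑ s, joint s (P.updTerm lamC L z (.inl i) (a, s)) := by
  classical
  rw [priorTerm, attach_atMostOne]
  refine Finset.sum_congr rfl fun s _ => ?_
  simp only [updTerm, updVoid, updDens, likGen, mul_assoc]

/-- The two terms combined in `clutter_mul_attach_expo`, non-existence and a set in `newSets j`, are
the local hypotheses of the `j`-th new component. -/
lemma new_component_eq_sum (j : Fin m) :
    (1 + ∑ s ∈ newSets j,
        joint s (atMostOne (if s.card = 1 then ∏ p ∈ s, lamC (z p) else 0)
          fun x => P.lam x * likGen L z x s) : SetAlg T (SetAlg (Fin m) ℝ≥0∞)) =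
      ∑ h : Option {s : Finset (Fin m) // s ∈ newSets j},
        joint (P.nums (.inr j) h) (P.updTerm lamC L z (.inr j) h) := by
  rw [Fintype.sum_option, ← Finset.sum_coe_sort]
  congr 1
  · rw [← joint_empty_one, ← atMostOne_one_zero]
    rfl
  · refine Finset.sum_congr rfl fun s _ => ?_
    simp only [updTerm, updVoid, updDens, nums, likGen, Finset.prod_map]

/-- Bayes' rule before normalisation: the likelihood times the prior is a sum over the global
hypotheses of the update.  There are no divisions apart from the prior normalisation, so the
identity holds at every finite set, whatever values are infinite. -/
theorem likelihood_mul_density [MeasurableSpace T] (ν : Measure T) [MeasurableSpace Z]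
    (νZ : Measure Z) (X : Finset T) :
    multiLikelihood νZ lamC L (Finset.univ.map z) X * P.density ν X =
      voidProb νZ lamC * (voidProb ν P.lam * P.totalWeight⁻¹) *
        ∑ a ∈ P.updGlobalHyps m,
          (expo (fun x => L ∅ x * P.lam x) *
            ∏ i : P.Comp ⊕ Fin m, P.updTerm lamC L z i (a i)) X := by
  classical
  have key : const (expo fun p => lamC (z p)) *
      attach (likGen L z) (expo P.lam * ∑ a ∈ P.globalHyps, ∏ i, P.priorTerm i (a i)) =
      ∑ a : ∀ i, P.UpdHyp m i, if (P.updHypEquiv m a).1 ∈ P.globalHyps then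
        joint ∅ (expo fun x => L ∅ x * P.lam x) *
          ∏ i : P.Comp ⊕ Fin m, joint (P.nums i (a i)) (P.updTerm lamC L z i (a i)) else 0 := by
    have hsplit : ∀ b, ∏ i : P.Comp ⊕ Fin m, joint (P.nums i ((P.updHypEquiv m).symm b i))
        (P.updTerm lamC L z i ((P.updHypEquiv m).symm b i)) =
        (∏ i, joint (b.2.1 i) (P.updTerm lamC L z (.inl i) (b.1 i, b.2.1 i))) *
          ∏ j, joint (P.nums (.inr j) (b.2.2 j)) (P.updTerm lamC L z (.inr j) (b.2.2 j)) :=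
      fun b => Fintype.prod_sum_type _
    rw [map_mul, ← mul_assoc, clutter_mul_attach_expo, map_sum,
      ← (P.updHypEquiv m).symm.sum_comp]
    simp only [Equiv.apply_symm_apply, hsplit]
    rw [Fintype.sum_prod_type, ← Finset.univ_inter P.globalHyps, ← Finset.sum_ite_mem,
      Finset.mul_sum]
    refine Finset.sum_congr rfl fun a _ => ?_
    by_cases ha : a ∈ P.globalHyps
    · simp only [Finset.univ_inter, ha, if_true, map_prod, attach_priorTerm P lamC L z,
        new_component_eq_sum, Finset.prod_univ_sum, Fintype.piFinset_univ]
      rw [Fintype.sum_prod_type, mul_assoc, mul_comm (∑ τ, _), Finset.sum_mul_sum, Finset.mul_sum]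
      simp only [Finset.mul_sum]
      rfl
    · simp [ha]
  -- The measurement indeterminates enter through the coefficient ring, and Bayes' rule concerns the
  -- coefficient of the product of all of them.
  have hc : ∀ F : SetAlg T ℝ≥0∞, ((expo fun p => lamC (z p)) * ∏ x ∈ X, likGen L z x)
      Finset.univ * F X =
      (const (expo fun p => lamC (z p)) * attach (likGen L z) F :
        SetAlg T (SetAlg (Fin m) ℝ≥0∞)) X Finset.univ := by
    intro F
    rw [const_mul_apply', attach_apply, mul_left_comm, const_mul_apply', mul_comm]
  rw [multiLikelihood_map, density_eq_priorTerm, mul_mul_mul_comm, hc, key]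
  congr 1
  rw [SetAlg.sum_apply, SetAlg.sum_apply, updGlobalHyps, Finset.sum_filter]
  refine Finset.sum_congr rfl fun a _ => ?_
  rw [ite_and]
  -- The product of the measurement monomials is the full monomial exactly for a splitting of the
  -- measurements.
  split_ifs with _ h2
  · rw [prod_of_disjoint_mul joint joint_empty_one joint_mul Finset.univ
      (fun i => P.nums i (a i)) fun i => P.updTerm lamC L z i (a i),
      if_pos fun i _ j _ => h2.1 i j, h2.2, joint_mul, if_pos (Finset.disjoint_empty_left _),
      joint_apply, mono_apply, if_pos (Finset.empty_union _).symm]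
  · rw [prod_of_disjoint_mul joint joint_empty_one joint_mul Finset.univ
      (fun i => P.nums i (a i)) fun i => P.updTerm lamC L z i (a i)]
    split_ifs with h3
    · rw [joint_mul, if_pos (Finset.disjoint_empty_left _), joint_apply, mono_apply, if_neg]
      rw [Finset.empty_union]
      exact fun h => h2 ⟨fun i j => h3 i (Finset.mem_univ _) j (Finset.mem_univ _), h.symm⟩
    · rw [mul_zero]
      rfl
  · rfl

end Update
end PMBM

/-! ### Set integrals of convolutions -/

section SetIntegral

variable {T : Type*} [MeasurableSpace T]

/-- A set function is measurable if its composition with the map from `ι`-tuples of distinct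
elements to sets agrees with a measurable function of tuples, for every finite index type `ι`. -/
def SetMeasurable (F : SetAlg T ℝ≥0∞) : Prop :=
  ∀ (ι : Type) [Fintype ι], ∃ φ : (ι → T) → ℝ≥0∞, Measurable φ ∧
    ∀ x : ι ↪ T, F (Finset.univ.map x) = φ x

lemma setMeasurable_expo {φ : T → ℝ≥0∞} (hφ : Measurable φ) : SetMeasurable (expo φ) := by
  intro ι _
  refine ⟨fun x => ∏ i, φ (x i),
    Finset.measurable_fun_prod _ fun i _ => hφ.comp (measurable_pi_apply i), fun x => ?_⟩
  rw [expo_apply, Finset.prod_map]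

lemma setMeasurable_atMostOne (c : ℝ≥0∞) {φ : T → ℝ≥0∞} (hφ : Measurable φ) :
    SetMeasurable (atMostOne c φ) := by
  classical
  intro ι _
  refine ⟨fun x => if Fintype.card ι = 0 then c else
    if Fintype.card ι = 1 then ∏ i, φ (x i) else 0, ?_, fun x => ?_⟩
  · split_ifs
    · exact measurable_const
    · exact Finset.measurable_fun_prod _ fun i _ => hφ.comp (measurable_pi_apply i)
    · exact measurable_const
  · simp only [atMostOne, Finset.card_map, Finset.card_univ, Finset.prod_map,
      ← Finset.card_eq_zero]

lemma setMeasurable_one : SetMeasurable (1 : SetAlg T ℝ≥0∞) := by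
  rw [← expo_zero]
  exact setMeasurable_expo measurable_zero

/-- Convolution in terms of tuples of distinct elements: the subsets of the set of entries
correspond to the subsets of the index type. -/
lemma mul_univ_map {T ι : Type*} [Fintype ι] [DecidableEq ι] (F G : SetAlg T ℝ≥0∞) (x : ι ↪ T) :
    (F * G) (Finset.univ.map x) =
      ∑ A : Finset ι,
        F (Finset.univ.map ((Function.Embedding.subtype (· ∈ A)).trans x)) *
          G (Finset.univ.map ((Function.Embedding.subtype (· ∉ A)).trans x)) := by
  classical
  rw [mul_apply]
  refine (Finset.sum_nbij (fun A => A.map x) ?_ ?_ ?_ ?_).symm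
  · intro A _
    exact Finset.mem_powerset.2 (Finset.map_subset_map.2 (Finset.subset_univ A))
  · exact (Finset.map_injective x).injOn
  · intro Y hY
    obtain ⟨W, _, rfl⟩ := Finset.subset_map_iff.1 (Finset.mem_powerset.1 hY)
    exact ⟨W, by simp, rfl⟩
  · intro A _
    congr 2
    · ext y; simp
    · ext y
      simp only [Finset.mem_map, Finset.mem_univ, true_and, Finset.mem_sdiff, Subtype.exists,
        Function.Embedding.trans_apply, Function.Embedding.subtype_apply]
      constructor
      · rintro ⟨i, hi, rfl⟩
        exact ⟨⟨i, rfl⟩, fun ⟨j, hj, hij⟩ => hi (x.injective hij ▸ hj)⟩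
      · rintro ⟨⟨i, rfl⟩, h⟩
        exact ⟨i, fun hi => h ⟨i, hi, rfl⟩, rfl⟩

lemma SetMeasurable.mul {F G : SetAlg T ℝ≥0∞} (hF : SetMeasurable F) (hG : SetMeasurable G) :
    SetMeasurable (F * G) := by
  classical
  intro ι _
  choose φ hφ hFφ using fun A : Finset ι => hF {i // i ∈ A}
  choose γ hγ hGγ using fun A : Finset ι => hG {i // i ∉ A}
  refine ⟨fun x => ∑ A : Finset ι, φ A (fun i => x i) * γ A (fun i => x i), ?_, fun x => ?_⟩
  · refine Finset.measurable_fun_sum _ fun A _ => Measurable.mul ?_ ?_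
    · exact (hφ A).comp (measurable_pi_lambda _ fun i => measurable_pi_apply _)
    · exact (hγ A).comp (measurable_pi_lambda _ fun i => measurable_pi_apply _)
  · rw [mul_univ_map]
    refine Finset.sum_congr rfl fun A _ => ?_
    rw [hFφ, hGγ]
    rfl

lemma SetMeasurable.prod {κ : Type*} (s : Finset κ) {F : κ → SetAlg T ℝ≥0∞}
    (hF : ∀ i ∈ s, SetMeasurable (F i)) : SetMeasurable (∏ i ∈ s, F i) :=
  Finset.prod_induction _ _ (fun _ _ => SetMeasurable.mul) setMeasurable_one hF

variable (ν : Measure T)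

/-- The integral of a set function over the sets with `n` elements, listed in all orders. -/
def tupleIntegral (F : SetAlg T ℝ≥0∞) (n : ℕ) : ℝ≥0∞ :=
  ∫⁻ x : Fin n → T, F (tupleSet x) ∂(Measure.pi fun _ => ν)

lemma setIntegral_eq (F : SetAlg T ℝ≥0∞) :
    setIntegral ν F = ∑' n : ℕ, (n.factorial : ℝ≥0∞)⁻¹ * tupleIntegral ν F n := rfl

lemma tupleSet_embedding {T : Type*} {n : ℕ} (x : Fin n ↪ T) : tupleSet x = Finset.univ.map x := by
  classical
  rw [tupleSet, Finset.map_eq_image]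

lemma mem_tupleSet {T : Type*} {n : ℕ} {x : Fin n → T} {y : T} :
    y ∈ tupleSet x ↔ ∃ j, x j = y := by
  simp [tupleSet]

variable [SigmaFinite ν] [NullSingletonClass ν] [MeasurableEq T]

/-- As single points are null sets, almost all tuples have distinct entries. -/
lemma ae_injective (ι : Type*) [Fintype ι] :
    ∀ᵐ x : ι → T ∂(Measure.pi fun _ => ν), Function.Injective x := by
  classical
  have h : ∀ i j : ι, i ≠ j → ∀ᵐ x : ι → T ∂(Measure.pi fun _ => ν), x i ≠ x j := by
    intro i j hij
    have hs : MeasurableSet {y : ({a // a = i} → T) × ({a // a ≠ i} → T) |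
        y.1 ⟨i, rfl⟩ = y.2 ⟨j, hij.symm⟩} :=
      measurableSet_eq_fun ((measurable_pi_apply _).comp measurable_fst)
        ((measurable_pi_apply _).comp measurable_snd)
    have h1 := (measurePreserving_piEquivPiSubtypeProd (fun _ : ι => ν) (· = i)).measure_preimage
      hs.nullMeasurableSet
    rw [Measure.measure_prod_null hs |>.2] at h1
    · rw [ae_iff]
      simpa using h1
    · refine Filter.Eventually.of_forall fun a => ?_
      have h2 := Measure.pi_hyperplane (fun _ : {a // a ≠ i} => ν) ⟨j, hij.symm⟩ (a ⟨i, rfl⟩)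
      simpa [eq_comm] using h2
  have h' : ∀ᵐ x : ι → T ∂(Measure.pi fun _ => ν), ∀ i j : ι, i ≠ j → x i ≠ x j := by
    simp only [ae_all_iff]
    exact h
  filter_upwards [h'] with x hx i j hij
  by_contra hne
  exact hx i j hne hij

/-- The integral over sets with `n` elements only depends on the values at tuples of distinct
elements, and these may be listed by an arbitrary index type. -/
lemma lintegral_eq_tupleIntegral {ι : Type} [Fintype ι] {F : SetAlg T ℝ≥0∞}
    {φ : (ι → T) → ℝ≥0∞} (hφ : ∀ x : ι ↪ T, F (Finset.univ.map x) = φ x) :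
    ∫⁻ x, φ x ∂(Measure.pi fun _ => ν) = tupleIntegral ν F (Fintype.card ι) := by
  have e := (Fintype.equivFin ι).symm
  rw [tupleIntegral, ← (measurePreserving_piCongrLeft (fun _ : ι => ν) e).lintegral_comp_emb
    (MeasurableEquiv.measurableEmbedding _)]
  refine lintegral_congr_ae ?_
  filter_upwards [ae_injective ν (Fin (Fintype.card ι))] with x hx
  have h1 : (MeasurableEquiv.piCongrLeft (fun _ : ι => T) e) x = x ∘ e.symm := by
    funext i
    obtain ⟨k, rfl⟩ := e.surjective i
    rw [MeasurableEquiv.coe_piCongrLeft, Equiv.piCongrLeft_apply_apply]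
    simp
  let y : Fin (Fintype.card ι) ↪ T := ⟨x, hx⟩
  have h2 := hφ (e.symm.toEmbedding.trans y)
  rw [h1]
  refine h2.symm.trans ?_
  rw [show x = y from rfl, tupleSet_embedding, ← Finset.map_map]
  congr 1
  simp

/-- The sum over the subsets of the `n` indices depends only on their cardinalities, by Fubini. -/
lemma tupleIntegral_mul {F G : SetAlg T ℝ≥0∞} (hF : SetMeasurable F) (hG : SetMeasurable G)
    (n : ℕ) : tupleIntegral ν (F * G) n = ∑ p ∈ Finset.HasAntidiagonal.antidiagonal n,
      (n.choose p.1 : ℝ≥0∞) * (tupleIntegral ν F p.1 * tupleIntegral ν G p.2) := by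
  classical
  choose φ hφ hFφ using fun A : Finset (Fin n) => hF {i // i ∈ A}
  choose γ hγ hGγ using fun A : Finset (Fin n) => hG {i // i ∉ A}
  have h1 : ∀ x : Fin n ↪ T, (F * G) (Finset.univ.map x) =
      ∑ A : Finset (Fin n), φ A (fun i => x i) * γ A (fun i => x i) := by
    intro x
    rw [mul_univ_map]
    refine Finset.sum_congr rfl fun A _ => ?_
    rw [hFφ, hGγ]
    rfl
  have h2 := lintegral_eq_tupleIntegral ν (φ := fun x : Fin n → T =>
    ∑ A : Finset (Fin n), φ A (fun i => x i) * γ A (fun i => x i)) h1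
  rw [Fintype.card_fin] at h2
  rw [← h2, lintegral_finsetSum]
  · have h3 : ∀ A : Finset (Fin n),
        ∫⁻ x : Fin n → T, φ A (fun i => x i) * γ A (fun i => x i) ∂(Measure.pi fun _ => ν) =
          tupleIntegral ν F A.card * tupleIntegral ν G (n - A.card) := by
      intro A
      have h4 := (measurePreserving_piEquivPiSubtypeProd (fun _ : Fin n => ν)
        (· ∈ A)).lintegral_comp_emb (MeasurableEquiv.measurableEmbedding _)
        fun y => φ A y.1 * γ A y.2
      have h5 := lintegral_prod_mul (μ := Measure.pi fun _ : {i // i ∈ A} => ν)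
        (ν := Measure.pi fun _ : {i // i ∉ A} => ν) (hφ A).aemeasurable (hγ A).aemeasurable
      rw [lintegral_eq_tupleIntegral ν (hFφ A), lintegral_eq_tupleIntegral ν (hGγ A),
        Fintype.card_coe, Fintype.card_subtype_compl, Fintype.card_fin, Fintype.card_coe] at h5
      exact h4.trans (by convert h5)
    simp only [h3]
    rw [Finset.Nat.sum_antidiagonal_eq_sum_range_succ
      (fun a b => (n.choose a : ℝ≥0∞) * (tupleIntegral ν F a * tupleIntegral ν G b)),
      ← Finset.powerset_univ, Finset.sum_powerset_apply_card
        (fun a => tupleIntegral ν F a * tupleIntegral ν G (n - a))]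
    simp [nsmul_eq_mul]
  · intro A _
    refine Measurable.mul ?_ ?_
    · exact (hφ A).comp (measurable_pi_lambda _ fun i => measurable_pi_apply _)
    · exact (hγ A).comp (measurable_pi_lambda _ fun i => measurable_pi_apply _)

/-- The set integral is multiplicative. -/
lemma setIntegral_mul {F G : SetAlg T ℝ≥0∞} (hF : SetMeasurable F) (hG : SetMeasurable G) :
    setIntegral ν (F * G : SetAlg T ℝ≥0∞) = setIntegral ν F * setIntegral ν G := by
  have h0 : ∀ n : ℕ, (n.factorial : ℝ≥0∞) ≠ 0 := fun n => by
    exact_mod_cast n.factorial_ne_zero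
  have h1 : ∀ n : ℕ, (n.factorial : ℝ≥0∞)⁻¹ * tupleIntegral ν (F * G) n =
      ∑ p ∈ Finset.HasAntidiagonal.antidiagonal n,
        ((p.1.factorial : ℝ≥0∞)⁻¹ * tupleIntegral ν F p.1) *
          ((p.2.factorial : ℝ≥0∞)⁻¹ * tupleIntegral ν G p.2) := by
    intro n
    rw [tupleIntegral_mul ν hF hG, Finset.mul_sum]
    refine Finset.sum_congr rfl fun p hp => ?_
    have hp' : p.1 + p.2 = n := Finset.HasAntidiagonal.mem_antidiagonal.1 hp
    have h2 : (n.factorial : ℝ≥0∞)⁻¹ * (n.choose p.1 : ℝ≥0∞) =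
        (p.1.factorial : ℝ≥0∞)⁻¹ * (p.2.factorial : ℝ≥0∞)⁻¹ := by
      have h3 : (n.choose p.1 * p.1.factorial * p.2.factorial : ℝ≥0∞) = n.factorial := by
        rw [← hp']
        exact_mod_cast (Nat.choose_symm_add (a := p.1) (b := p.2)) ▸
          Nat.add_choose_mul_factorial_mul_factorial p.1 p.2
      have ht : ∀ n : ℕ, (n.factorial : ℝ≥0∞) ≠ ∞ := fun n => ENNReal.natCast_ne_top _
      rw [← ENNReal.mul_inv (Or.inl (h0 _)) (Or.inl (ht _))]
      refine ENNReal.eq_inv_of_mul_eq_one_left ?_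
      rw [mul_assoc, ← mul_assoc (n.choose p.1 : ℝ≥0∞), h3]
      exact ENNReal.inv_mul_cancel (h0 _) (ht _)
    rw [← mul_assoc, h2]
    ring
  rw [setIntegral_eq, setIntegral_eq, setIntegral_eq, ← ENNReal.tsum_mul_right]
  simp only [h1, ← ENNReal.tsum_mul_left]
  rw [← ENNReal.tsum_prod (f := fun a b => ((a.factorial : ℝ≥0∞)⁻¹ * tupleIntegral ν F a) *
    ((b.factorial : ℝ≥0∞)⁻¹ * tupleIntegral ν G b)),
    ← Finset.HasAntidiagonal.sigmaAntidiagonalEquivProd.tsum_eq, ENNReal.tsum_sigma']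
  refine tsum_congr fun n => ?_
  rw [tsum_fintype, ← Finset.sum_coe_sort]
  rfl

omit [NullSingletonClass ν] [MeasurableEq T] in
lemma lintegral_prod_eq_pow {φ : T → ℝ≥0∞} (hφ : Measurable φ) (n : ℕ) :
    ∫⁻ x : Fin n → T, ∏ i, φ (x i) ∂(Measure.pi fun _ => ν) = (∫⁻ x, φ x ∂ν) ^ n := by
  induction n with
  | zero => simp
  | succ n ih =>
    have h1 := (measurePreserving_piFinSuccAbove (fun _ : Fin (n + 1) => ν) 0).lintegral_comp_emb
      (MeasurableEquiv.measurableEmbedding _) fun y => φ y.1 * ∏ i, φ (y.2 i)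
    have h2 := lintegral_prod_mul (μ := ν) (ν := Measure.pi fun _ : Fin n => ν)
      (f := φ) (g := fun y => ∏ i, φ (y i)) hφ.aemeasurable
      (Finset.measurable_fun_prod _ fun i _ => hφ.comp (measurable_pi_apply i)).aemeasurable
    rw [pow_succ', ← ih, ← h2, ← h1]
    refine lintegral_congr fun x => ?_
    rw [Fin.prod_univ_succ]
    rfl

lemma setIntegral_atMostOne (c : ℝ≥0∞) {φ : T → ℝ≥0∞} (hφ : Measurable φ) :
    setIntegral ν (atMostOne c φ) = c + ∫⁻ x, φ x ∂ν := by
  have h : ∀ n, tupleIntegral ν (atMostOne c φ) n =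
      if n = 0 then c else if n = 1 then ∫⁻ x, φ x ∂ν else 0 := by
    intro n
    have h1 := lintegral_eq_tupleIntegral ν (ι := Fin n) (F := atMostOne c φ)
      (φ := fun x => if n = 0 then c else if n = 1 then ∏ i, φ (x i) else 0) fun x => by
        simp only [atMostOne, Finset.card_map, Finset.card_univ, Finset.prod_map,
          ← Finset.card_eq_zero, Fintype.card_fin]
    rw [Fintype.card_fin] at h1
    rw [← h1]
    split_ifs with h2 h3
    · subst h2
      simp
    · rw [lintegral_prod_eq_pow ν hφ, h3, pow_one]
    · simp
  rw [setIntegral_eq, tsum_eq_sum (s := Finset.range 2)]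
  · simp [Finset.sum_range_succ, h]
  · intro n hn
    have h2 : n ≠ 0 ∧ n ≠ 1 := by
      rw [Finset.mem_range] at hn
      omega
    simp [h, h2]

/-- A Poisson density integrates to one. -/
lemma voidProb_mul_setIntegral_expo {φ : T → ℝ≥0∞} (hφ : Measurable φ)
    (hfin : ∫⁻ x, φ x ∂ν ≠ ∞) : voidProb ν φ * setIntegral ν (expo φ) = 1 := by
  have h : ∀ n, tupleIntegral ν (expo φ) n = (∫⁻ x, φ x ∂ν) ^ n := by
    intro n
    have h1 := lintegral_eq_tupleIntegral ν (ι := Fin n) (F := expo φ)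
      (φ := fun x => ∏ i, φ (x i)) fun x => by rw [expo_apply, Finset.prod_map]
    rw [Fintype.card_fin] at h1
    rw [← h1, lintegral_prod_eq_pow ν hφ]
  have hexp : setIntegral ν (expo φ) = ENNReal.ofReal (Real.exp (∫⁻ x, φ x ∂ν).toReal) := by
    rw [setIntegral_eq, Real.exp_eq_exp_ℝ, NormedSpace.exp_eq_tsum_div,
      ENNReal.ofReal_tsum_of_nonneg (fun n => by positivity) (Real.summable_pow_div_factorial _)]
    refine tsum_congr fun n => ?_
    rw [h, ENNReal.ofReal_div_of_pos (by positivity), ENNReal.ofReal_pow ENNReal.toReal_nonneg,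
      ENNReal.ofReal_toReal hfin, ENNReal.ofReal_natCast, ENNReal.div_eq_inv_mul]
  rw [hexp, voidProb, ← ENNReal.ofReal_mul (Real.exp_pos _).le, ← Real.exp_add]
  simp

omit [SigmaFinite ν] [NullSingletonClass ν] [MeasurableEq T] in
lemma setIntegral_const_mul {a : ℝ≥0∞} (ha : a ≠ ∞) (F : Finset T → ℝ≥0∞) :
    setIntegral ν (fun X => a * F X) = a * setIntegral ν F := by
  rw [setIntegral, setIntegral, ← ENNReal.tsum_mul_left]
  refine tsum_congr fun n => ?_
  rw [lintegral_const_mul' _ _ ha]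
  ring

omit [SigmaFinite ν] [NullSingletonClass ν] [MeasurableEq T] in
lemma setIntegral_congr {F G : Finset T → ℝ≥0∞} (h : SetAEEq ν F G) :
    setIntegral ν F = setIntegral ν G := by
  rw [setIntegral, setIntegral]
  exact tsum_congr fun n => by rw [lintegral_congr_ae (h n)]

lemma setIntegral_sum {κ : Type*} (s : Finset κ) {F : κ → SetAlg T ℝ≥0∞}
    (hF : ∀ a ∈ s, SetMeasurable (F a)) :
    setIntegral ν (fun X => ∑ a ∈ s, F a X) = ∑ a ∈ s, setIntegral ν (F a) := by
  classical
  have h : ∀ n, ∀ a ∈ s, AEMeasurable (fun x : Fin n → T => F a (tupleSet x))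
      (Measure.pi fun _ => ν) := by
    intro n a ha
    obtain ⟨φ, hφ, hFφ⟩ := hF a ha (Fin n)
    refine ⟨φ, hφ, ?_⟩
    filter_upwards [ae_injective ν (Fin n)] with x hx
    exact (congrArg (F a) (tupleSet_embedding ⟨x, hx⟩)).trans (hFφ ⟨x, hx⟩)
  simp only [setIntegral]
  rw [← Summable.tsum_finsetSum fun a _ => ENNReal.summable]
  refine tsum_congr fun n => ?_
  rw [lintegral_finsetSum' _ (h n), Finset.mul_sum]

lemma setIntegral_prod {κ : Type*} (s : Finset κ) {F : κ → SetAlg T ℝ≥0∞}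
    (hF : ∀ i ∈ s, SetMeasurable (F i)) :
    setIntegral ν (∏ i ∈ s, F i : SetAlg T ℝ≥0∞) = ∏ i ∈ s, setIntegral ν (F i) := by
  classical
  induction s using Finset.induction_on with
  | empty =>
    rw [Finset.prod_empty, Finset.prod_empty, ← atMostOne_one_zero,
      setIntegral_atMostOne ν _ measurable_const]
    simp
  | insert i s hi ih =>
    rw [Finset.prod_insert hi, Finset.prod_insert hi,
      setIntegral_mul ν (hF i (by simp)) (SetMeasurable.prod s fun j hj => hF j (by simp [hj])),
      ih fun j hj => hF j (by simp [hj])]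

end SetIntegral

/-! ### Normalisation of local hypotheses -/

section Normalise

variable {T : Type*} [MeasurableSpace T] (ν : Measure T)

/-- Dividing `ψ` by its integral is undone by multiplication, almost everywhere; if the integral is
infinite, then the finiteness assumption forces `a = 0`. -/
lemma ae_mul_lintegral_mul_div {ψ : T → ℝ≥0∞} (hψ : Measurable ψ) {a : ℝ≥0∞}
    (h : a * ∫⁻ x, ψ x ∂ν ≠ ∞) :
    ∀ᵐ x ∂ν, a * (∫⁻ y, ψ y ∂ν) * (ψ x / ∫⁻ y, ψ y ∂ν) = a * ψ x := by
  by_cases ha : a = 0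
  · simp [ha]
  by_cases h0 : ∫⁻ y, ψ y ∂ν = 0
  · filter_upwards [(lintegral_eq_zero_iff hψ).1 h0] with x hx
    rw [h0, hx]
    simp
  · have htop : ∫⁻ y, ψ y ∂ν ≠ ∞ := fun ht => h (by rw [ht, ENNReal.mul_top ha])
    refine Filter.Eventually.of_forall fun x => ?_
    rw [mul_assoc, ENNReal.mul_div_cancel h0 htop]

lemma lintegral_div_self {ψ : T → ℝ≥0∞} (hψ : Measurable ψ) (h0 : ∫⁻ y, ψ y ∂ν ≠ 0)
    (htop : ∫⁻ y, ψ y ∂ν ≠ ∞) : ∫⁻ x, ψ x / ∫⁻ y, ψ y ∂ν ∂ν = 1 := by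
  simp only [div_eq_mul_inv]
  rw [lintegral_mul_const _ hψ, ENNReal.mul_inv_cancel h0 htop]

/-- A set function supported on sets with at most one element is its integral times a Bernoulli
density, at all sets of points outside a null set. -/
lemma exists_ae_atMostOne_eq {w c r : ℝ≥0∞} {φ f : T → ℝ≥0∞} (hφ : Measurable φ)
    (hw : w = c + ∫⁻ x, φ x ∂ν) (hr : w ≠ 0 → w ≠ ∞ → w * r = ∫⁻ x, φ x ∂ν)
    (hf : w ≠ 0 → w ≠ ∞ → ∀ᵐ x ∂ν, (∫⁻ y, φ y ∂ν) * f x = φ x) :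
    ∃ Q : T → Prop, (∀ᵐ x ∂ν, Q x) ∧ ∀ X : Finset T, (∀ x ∈ X, Q x) →
      (w = 0 → atMostOne c φ X = 0) ∧
        (w ≠ 0 → w ≠ ∞ → atMostOne c φ X = w * atMostOne (1 - r) (fun x => r * f x) X) := by
  refine ⟨fun x => (w = 0 → φ x = 0) ∧ (w ≠ 0 → w ≠ ∞ → (∫⁻ y, φ y ∂ν) * f x = φ x), ?_, ?_⟩
  · refine Filter.Eventually.and ?_ ?_
    · by_cases h0 : w = 0
      · have h1 : ∫⁻ x, φ x ∂ν = 0 := (add_eq_zero.1 (hw.symm.trans h0)).2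
        filter_upwards [(lintegral_eq_zero_iff hφ).1 h1] with x hx _ using hx
      · exact Filter.Eventually.of_forall fun x h => absurd h h0
    · by_cases h0 : w = 0
      · exact Filter.Eventually.of_forall fun x h => absurd h0 h
      by_cases h1 : w = ∞
      · exact Filter.Eventually.of_forall fun x _ h => absurd h1 h
      filter_upwards [hf h0 h1] with x hx _ _ using hx
  · intro X
    induction X using card_cases with
    | h0 =>
      intro _
      simp only [atMostOne_empty]
      refine ⟨fun h0 => (add_eq_zero.1 (hw.symm.trans h0)).1, fun h0 h1 => ?_⟩
      have h2 : ∫⁻ x, φ x ∂ν ≠ ∞ := fun h => h1 (by rw [hw, h, add_top])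
      rw [ENNReal.mul_sub fun _ _ => h1, hr h0 h1, mul_one, hw, ENNReal.add_sub_cancel_right h2]
    | h1 x _ =>
      intro hQ
      obtain ⟨h0, h1⟩ := hQ x (Finset.mem_singleton_self x)
      simp only [atMostOne_singleton]
      refine ⟨h0, fun h2 h3 => ?_⟩
      rw [← mul_assoc, hr h2 h3, h1 h2 h3]
    | h2 h =>
      intro _
      simp [atMostOne_of_one_lt _ _ h]

end Normalise

/-! ### The updated parameters -/

namespace PMBM

variable {T : Type*} [MeasurableSpace T] {ν : Measure T} {D : Set T} {k : ℕ} {P : PMBM T}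
  {Z : Type*} {lamC : Z → ℝ≥0∞} {L : Finset Z → T → ℝ≥0∞} {m : ℕ} {z : Fin m ↪ Z}

lemma measurable_updDens (hP : P.Valid ν D k)
    (hL : ∀ s : Finset (Fin m), Measurable (L (s.map z))) (i : P.Comp ⊕ Fin m)
    (h : P.UpdHyp m i) : Measurable (P.updDens L z i h) := by
  rcases i with i | j
  · exact ((hP.f_measurable i h.1).mul (hL h.2)).const_mul _
  · rcases h with _ | s
    · exact measurable_const
    · exact hP.lam_measurable.mul (hL s.1)

/-- The weight of a local hypothesis is the set integral of its unnormalised contribution. -/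
lemma update_w_eq (hP : P.Valid ν D k)
    (hL : ∀ s : Finset (Fin m), Measurable (L (s.map z))) (i : P.Comp ⊕ Fin m)
    (h : P.UpdHyp m i) :
    (P.update ν lamC L z k).w i h = P.updVoid lamC z i h + ∫⁻ x, P.updDens L z i h x ∂ν := by
  rcases i with i | j
  · obtain ⟨a, s⟩ := h
    have h1 : ∫⁻ x, P.updDens L z (.inl i) (a, s) x ∂ν =
        P.w i a * P.r i a * P.detLik ν L z i a s :=
      lintegral_const_mul _ ((hP.f_measurable i a).mul (hL s))
    rw [h1]
    simp only [update, updVoid]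
    split_ifs with hs
    · rw [hs, mul_add, mul_assoc]
    · rw [zero_add]
  · rcases h with _ | s
    · simp [update, updVoid, updDens]
    · rfl

lemma update_w_mul_r (hP : P.Valid ν D k)
    (hL : ∀ s : Finset (Fin m), Measurable (L (s.map z))) (i : P.Comp ⊕ Fin m)
    (h : P.UpdHyp m i) (h0 : (P.update ν lamC L z k).w i h ≠ 0)
    (htop : (P.update ν lamC L z k).w i h ≠ ∞) :
    (P.update ν lamC L z k).w i h * (P.update ν lamC L z k).r i h =
      ∫⁻ x, P.updDens L z i h x ∂ν := by
  rcases i with i | j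
  · obtain ⟨a, s⟩ := h
    have h1 : ∫⁻ x, P.updDens L z (.inl i) (a, s) x ∂ν =
        P.w i a * P.r i a * P.detLik ν L z i a s :=
      lintegral_const_mul _ ((hP.f_measurable i a).mul (hL s))
    rw [h1]
    simp only [update] at h0 htop ⊢
    split_ifs at h0 htop ⊢ with hs
    · have h2 := left_ne_zero_of_mul h0
      have h3 := right_ne_zero_of_mul h0
      have h4 : 1 - P.r i a + P.r i a * P.detLik ν L z i a ∅ ≠ ∞ := fun h =>
        htop (by rw [h, ENNReal.mul_top h2])
      rw [mul_assoc, ENNReal.mul_div_cancel h3 h4, hs, mul_assoc]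
    · rw [mul_one]
  · rcases h with _ | s
    · simp [update, updDens]
    · exact ENNReal.mul_div_cancel h0 htop

lemma ae_lintegral_mul_update_f (hP : P.Valid ν D k)
    (hL : ∀ s : Finset (Fin m), Measurable (L (s.map z))) (i : P.Comp ⊕ Fin m)
    (h : P.UpdHyp m i) (htop : (P.update ν lamC L z k).w i h ≠ ∞) :
    ∀ᵐ x ∂ν, (∫⁻ y, P.updDens L z i h y ∂ν) * (P.update ν lamC L z k).f i h x =
      P.updDens L z i h x := by
  have hfin : ∫⁻ x, P.updDens L z i h x ∂ν ≠ ∞ := fun h1 =>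
    htop (by rw [update_w_eq hP hL, h1, add_top])
  rcases i with i | j
  · obtain ⟨a, s⟩ := h
    have hm := (hP.f_measurable i a).mul (hL s)
    have h1 : ∫⁻ x, P.updDens L z (.inl i) (a, s) x ∂ν =
        P.w i a * P.r i a * ∫⁻ x, P.f i a x * L (s.map z) x ∂ν := lintegral_const_mul _ hm
    rw [h1] at hfin ⊢
    filter_upwards [ae_mul_lintegral_mul_div ν hm hfin] with x hx
    simp only [update, detLik, mul_comm (L (s.map z) x)]
    exact hx
  · rcases h with _ | s
    · simp [update, updDens]
    · have hm := hP.lam_measurable.mul (hL s.1)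
      have hfin' : 1 * ∫⁻ x, P.lam x * L (s.1.map z) x ∂ν ≠ ∞ := by
        rw [one_mul]
        exact hfin
      filter_upwards [ae_mul_lintegral_mul_div ν hm hfin'] with x hx
      rw [one_mul, one_mul] at hx
      simp only [update, newLik, mul_comm (L (s.1.map z) x)]
      exact hx

lemma lintegral_update_f (hP : P.Valid ν D k)
    (hL : ∀ s : Finset (Fin m), Measurable (L (s.map z))) (i : P.Comp ⊕ Fin m)
    (h : P.UpdHyp m i) (h0 : (P.update ν lamC L z k).w i h ≠ 0)
    (htop : (P.update ν lamC L z k).w i h ≠ ∞) (hr : (P.update ν lamC L z k).r i h ≠ 0) :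
    ∫⁻ x, (P.update ν lamC L z k).f i h x ∂ν = 1 := by
  have hfin : ∫⁻ x, P.updDens L z i h x ∂ν ≠ ∞ := fun h1 =>
    htop (by rw [update_w_eq hP hL, h1, add_top])
  have hne : ∫⁻ x, P.updDens L z i h x ∂ν ≠ 0 := by
    rw [← update_w_mul_r hP hL i h h0 htop]
    exact mul_ne_zero h0 hr
  rcases i with i | j
  · obtain ⟨a, s⟩ := h
    have hm := (hP.f_measurable i a).mul (hL s)
    have h1 : ∫⁻ x, P.updDens L z (.inl i) (a, s) x ∂ν =
        P.w i a * P.r i a * ∫⁻ x, P.f i a x * L (s.map z) x ∂ν := lintegral_const_mul _ hm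
    rw [h1] at hfin hne
    simp only [update, detLik, mul_comm (L (s.map z) _)]
    refine lintegral_div_self ν hm (right_ne_zero_of_mul hne) fun ht => hfin ?_
    rw [ht, ENNReal.mul_top (left_ne_zero_of_mul hne)]
  · rcases h with _ | s
    · exact absurd rfl hr
    · simp only [update, newLik, mul_comm (L (s.1.map z) _)]
      exact lintegral_div_self ν (hP.lam_measurable.mul (hL s.1)) hne hfin

lemma update_r_le_one (i : P.Comp ⊕ Fin m) (h : P.UpdHyp m i) :
    (P.update ν lamC L z k).r i h ≤ 1 := by
  rcases i with i | j
  · obtain ⟨a, s⟩ := h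
    simp only [update]
    split_ifs
    · exact ENNReal.div_le_of_le_mul (by rw [one_mul]; exact le_add_self)
    · exact le_rfl
  · rcases h with _ | s
    · exact zero_le_one
    · exact ENNReal.div_le_of_le_mul (by rw [one_mul]; exact le_add_self)

lemma measurable_update_f (hP : P.Valid ν D k)
    (hL : ∀ s : Finset (Fin m), Measurable (L (s.map z))) (i : P.Comp ⊕ Fin m)
    (h : P.UpdHyp m i) : Measurable ((P.update ν lamC L z k).f i h) := by
  rcases i with i | j
  · exact ((hL h.2).mul (hP.f_measurable i h.1)).div_const _
  · rcases h with _ | s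
    · exact measurable_const
    · exact ((hL s.1).mul hP.lam_measurable).div_const _

lemma update_f_support (hP : P.Valid ν D k) (i : P.Comp ⊕ Fin m) (h : P.UpdHyp m i) (x : T)
    (hx : x ∉ D) : (P.update ν lamC L z k).f i h x = 0 := by
  rcases i with i | j
  · obtain ⟨a, s⟩ := h
    simp [update, hP.f_support i a x hx]
  · rcases h with _ | s
    · rfl
    · simp [update, hP.lam_support x hx]

lemma update_assoc_subset (hP : P.Valid ν D k) (i : P.Comp ⊕ Fin m) (h : P.UpdHyp m i) :
    (P.update ν lamC L z k).assoc i h ⊆ (P.update ν lamC L z k).meas := by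
  rw [P.update_assoc]
  refine Finset.union_subset_union ?_ (Finset.image_subset_image (Finset.subset_univ _))
  rcases i with i | j
  · exact hP.assoc_subset _ _
  · exact Finset.empty_subset _

lemma totalWeight_update (hP : P.Valid ν D k) :
    (P.update ν lamC L z k).totalWeight =
      ∑ a ∈ P.updGlobalHyps m, ∏ i : P.Comp ⊕ Fin m, (P.update ν lamC L z k).w i (a i) :=
  Finset.sum_congr (P.globalHyps_update lamC L z ν hP.assoc_subset hP.meas_time) fun _ _ => rfl

lemma setMeasurable_updTerm_prod (hP : P.Valid ν D k)
    (hL : ∀ s : Finset (Fin m), Measurable (L (s.map z)))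
    (a : ∀ i : P.Comp ⊕ Fin m, P.UpdHyp m i) :
    SetMeasurable (∏ i : P.Comp ⊕ Fin m, P.updTerm lamC L z i (a i)) :=
  SetMeasurable.prod _ fun i _ => setMeasurable_atMostOne _ (measurable_updDens hP hL i (a i))

variable [SigmaFinite ν] [NullSingletonClass ν] [MeasurableEq T]

lemma setIntegral_updTerm_prod (hP : P.Valid ν D k)
    (hL : ∀ s : Finset (Fin m), Measurable (L (s.map z)))
    (a : ∀ i : P.Comp ⊕ Fin m, P.UpdHyp m i) :
    setIntegral ν (∏ i : P.Comp ⊕ Fin m, P.updTerm lamC L z i (a i) : SetAlg T ℝ≥0∞) =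
      ∏ i : P.Comp ⊕ Fin m, (P.update ν lamC L z k).w i (a i) := by
  rw [setIntegral_prod]
  · refine Finset.prod_congr rfl fun i _ => ?_
    rw [update_w_eq hP hL]
    exact setIntegral_atMostOne ν _ (measurable_updDens hP hL i (a i))
  · exact fun i _ => setMeasurable_atMostOne _ (measurable_updDens hP hL i (a i))

/-- The normalising constant of Bayes' rule is, up to constant factors, the total weight of the
updated parameters. -/
lemma evidence_eq [MeasurableSpace Z] (νZ : Measure Z) (hP : P.Valid ν D k)
    (hL : ∀ s : Finset (Fin m), Measurable (L (s.map z))) {g : Finset T → ℝ≥0∞}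
    (hg : SetAEEq ν g (P.density ν)) :
    evidence ν (multiLikelihood νZ lamC L (Finset.univ.map z)) g =
      voidProb νZ lamC * (voidProb ν P.lam * P.totalWeight⁻¹) *
        (setIntegral ν (expo fun x => L ∅ x * P.lam x) *
          (P.update ν lamC L z k).totalWeight) := by
  have hexpo : SetMeasurable (expo fun x => L ∅ x * P.lam x) :=
    setMeasurable_expo ((hL ∅).mul hP.lam_measurable)
  have hae : SetAEEq ν (fun X => multiLikelihood νZ lamC L (Finset.univ.map z) X * g X)
      fun X => multiLikelihood νZ lamC L (Finset.univ.map z) X * P.density ν X := by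
    intro n
    filter_upwards [hg n] with x hx
    rw [hx]
  have hsum := setIntegral_sum ν (P.updGlobalHyps m)
    (F := fun a => (expo fun x => L ∅ x * P.lam x) *
      ∏ i : P.Comp ⊕ Fin m, P.updTerm lamC L z i (a i))
    fun a _ => hexpo.mul (setMeasurable_updTerm_prod hP hL a)
  have hfin : voidProb νZ lamC * (voidProb ν P.lam * P.totalWeight⁻¹) ≠ ∞ :=
    ENNReal.mul_ne_top (voidProb_ne_top _ _) (ENNReal.mul_ne_top (voidProb_ne_top _ _)
      (ENNReal.inv_ne_top.2 hP.totalWeight_ne_zero))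
  rw [evidence, setIntegral_congr ν hae]
  simp only [likelihood_mul_density]
  rw [setIntegral_const_mul ν hfin, hsum, totalWeight_update hP,
    Finset.mul_sum (a := setIntegral ν (expo fun x => L ∅ x * P.lam x))]
  refine congrArg _ (Finset.sum_congr rfl fun a _ => ?_)
  rw [setIntegral_mul ν hexpo (setMeasurable_updTerm_prod hP hL a),
    setIntegral_updTerm_prod (k := k) hP hL a]

end PMBM

/-! ### The posterior density -/

namespace PMBM

section Posterior

variable {T : Type*} [MeasurableSpace T] {ν : Measure T} {D : Set T} {k : ℕ} {P : PMBM T}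
  {Z : Type*} {lamC : Z → ℝ≥0∞} {L : Finset Z → T → ℝ≥0∞} {m : ℕ} {z : Fin m ↪ Z}

omit [MeasurableSpace T] in
/-- Normalising the contributions of the local hypotheses of a global hypothesis.  A global
hypothesis of weight zero has a local hypothesis whose contribution vanishes. -/
lemma mul_updTerm_prod_apply {X : Finset T} {a : ∀ i : P.Comp ⊕ Fin m, P.UpdHyp m i}
    {w r : (i : P.Comp ⊕ Fin m) → ℝ≥0∞} {f : (i : P.Comp ⊕ Fin m) → T → ℝ≥0∞}
    (hfin : ∏ i, w i ≠ ∞) (E : SetAlg T ℝ≥0∞)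
    (h0 : ∀ i, ∀ Y ⊆ X, w i = 0 → P.updTerm lamC L z i (a i) Y = 0)
    (h1 : ∀ i, ∀ Y ⊆ X, w i ≠ 0 → w i ≠ ∞ →
      P.updTerm lamC L z i (a i) Y = w i * atMostOne (1 - r i) (fun x => r i * f i x) Y) :
    (E * ∏ i, P.updTerm lamC L z i (a i)) X =
      (∏ i, w i) * (E * ∏ i, atMostOne (1 - r i) fun x => r i * f i x) X := by
  classical
  by_cases hw : ∏ i, w i = 0
  · obtain ⟨i, hi, hwi⟩ := Finset.prod_eq_zero_iff.1 hw
    rw [hw, zero_mul, ← Finset.mul_prod_erase _ _ hi,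
      mul_congr (F' := E) (G' := 0) (fun _ _ => rfl)]
    · rw [mul_zero, SetAlg.zero_apply]
    · intro Y hY
      rw [mul_congr (F' := 0) (fun W hW => h0 i W (hW.trans hY) hwi) fun _ _ => rfl, zero_mul]
  · have hne : ∀ i, w i ≠ 0 := fun i hi => hw (Finset.prod_eq_zero (Finset.mem_univ i) hi)
    have hnt : ∀ i, w i ≠ ∞ := fun i hi => hfin (by
      rw [← Finset.mul_prod_erase _ _ (Finset.mem_univ i), hi]
      exact ENNReal.top_mul (Finset.prod_ne_zero_iff.2 fun j _ => hne j))
    rw [← const_mul_apply', mul_left_comm, map_prod, ← Finset.prod_mul_distrib]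
    refine mul_congr (fun _ _ => rfl) fun Y hY => SetAlg.prod_congr _ (fun i _ W hW => ?_) Y hY
    rw [const_mul_apply']
    exact h1 i W hW (hne i) (hnt i)

variable [SigmaFinite ν] [NullSingletonClass ν] [MeasurableEq T]

/-- Bayes' rule for a PMBM prior, on an arbitrary space of single-element states. -/
theorem represents_update [MeasurableSpace Z] (νZ : Measure Z) {g : Finset T → ℝ≥0∞}
    (hP : P.Represents ν D k g) (hL : ∀ s : Finset (Fin m), Measurable (L (s.map z)))
    (hL1 : ∀ x, L ∅ x ≤ 1)
    (h0 : evidence ν (multiLikelihood νZ lamC L (Finset.univ.map z)) g ≠ 0)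
    (htop : evidence ν (multiLikelihood νZ lamC L (Finset.univ.map z)) g ≠ ∞) :
    (P.update ν lamC L z k).Represents ν D (k + 1)
      (posterior ν (multiLikelihood νZ lamC L (Finset.univ.map z)) g) := by
  obtain ⟨hV, hg⟩ := hP
  have hev := evidence_eq νZ (lamC := lamC) hV hL hg
  have hlam : Measurable fun x => L ∅ x * P.lam x := (hL ∅).mul hV.lam_measurable
  have hlam_fin : ∫⁻ x, L ∅ x * P.lam x ∂ν ≠ ∞ := by
    refine ne_top_of_le_ne_top hV.lam_integral (lintegral_mono fun x => ?_)
    exact mul_le_of_le_one_left zero_le (hL1 x)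
  set K := voidProb νZ lamC * (voidProb ν P.lam * P.totalWeight⁻¹) with hK
  have hK0 : K ≠ 0 := mul_ne_zero (voidProb_ne_zero _ _)
    (mul_ne_zero (voidProb_ne_zero _ _) (ENNReal.inv_ne_zero.2 hV.totalWeight_ne_top))
  have hKtop : K ≠ ∞ := ENNReal.mul_ne_top (voidProb_ne_top _ _)
    (ENNReal.mul_ne_top (voidProb_ne_top _ _) (ENNReal.inv_ne_top.2 hV.totalWeight_ne_zero))
  set I := setIntegral ν (expo fun x => L ∅ x * P.lam x) with hI
  have hvI : voidProb ν (fun x => L ∅ x * P.lam x) * I = 1 :=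
    voidProb_mul_setIntegral_expo ν hlam hlam_fin
  have hI0 : I ≠ 0 := right_ne_zero_of_mul (hvI.trans_ne one_ne_zero)
  have hItop : I ≠ ∞ := fun h => by
    rw [h, ENNReal.mul_top (voidProb_ne_zero _ _)] at hvI
    exact ENNReal.top_ne_one hvI
  set P' := P.update ν lamC L z k with hP'
  have htw0 : P'.totalWeight ≠ 0 := fun h => h0 (by rw [hev, h, mul_zero, mul_zero])
  have htw : P'.totalWeight ≠ ∞ := fun h => htop (by
    rw [hev, h, ENNReal.mul_top hI0, ENNReal.mul_top hK0])
  refine ⟨?_, ?_⟩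
  · exact
    { lam_measurable := hlam
      lam_integral := hlam_fin
      lam_support := fun x hx => by
        change L ∅ x * P.lam x = 0
        rw [hV.lam_support x hx, mul_zero]
      r_le_one := update_r_le_one
      f_measurable := measurable_update_f hV hL
      f_support := fun i h x hx => update_f_support hV i h x hx
      f_integral := lintegral_update_f hV hL
      totalWeight_ne_zero := htw0
      totalWeight_ne_top := htw
      assoc_subset := update_assoc_subset hV
      meas_time := fun p hp => by
        rcases Finset.mem_union.1 hp with hp | hp
        · exact (hV.meas_time p hp).trans (Nat.lt_succ_self k)
        · obtain ⟨q, _, rfl⟩ := mem_pairs.1 hp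
          exact Nat.lt_succ_self k }
  · choose Q hQ hQX using fun (i : P.Comp ⊕ Fin m) (h : P.UpdHyp m i) =>
      exists_ae_atMostOne_eq ν (measurable_updDens hV hL i h)
        (update_w_eq (lamC := lamC) (k := k) hV hL i h) (update_w_mul_r hV hL i h)
        fun _ => ae_lintegral_mul_update_f hV hL i h
    have hQall : ∀ᵐ x ∂ν, ∀ i h, Q i h x := by
      rw [ae_all_iff]
      intro i
      have : Finite (P.UpdHyp m i) := Finite.of_fintype _
      rw [ae_all_iff]
      exact hQ i
    intro n
    have hQn : ∀ᵐ x : Fin n → T ∂(Measure.pi fun _ => ν), ∀ j, ∀ i h, Q i h (x j) :=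
      ae_all_iff.2 fun j =>
        (Measure.tendsto_eval_ae_ae (μ := fun _ : Fin n => ν) (i := j)).eventually hQall
    filter_upwards [hg n, hQn] with x hgx hQx
    set X := tupleSet x with hX
    have hgood : ∀ Y ⊆ X, ∀ i h, ∀ y ∈ Y, Q i h y := by
      intro Y hY i h y hy
      obtain ⟨j, rfl⟩ := mem_tupleSet.1 (hY hy)
      exact hQx j i h
    have hsum : P'.density ν X = voidProb ν (fun x => L ∅ x * P.lam x) *
        ∑ a ∈ P.updGlobalHyps m, P'.totalWeight⁻¹ *
          ((expo fun x => L ∅ x * P.lam x) *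
            ∏ i : P.Comp ⊕ Fin m, P.updTerm lamC L z i (a i)) X := by
      rw [density_eq_sum]
      refine congrArg _ (Finset.sum_congr
        (P.globalHyps_update lamC L z ν hV.assoc_subset hV.meas_time) fun a ha => ?_)
      -- Finiteness of the evidence bounds the weight of each global hypothesis separately; a local
      -- weight may still be infinite if another factor is zero.
      have hfin : ∏ i : P.Comp ⊕ Fin m, P'.w i (a i) ≠ ∞ := by
        rw [hP', totalWeight_update hV] at htw
        exact (ENNReal.sum_ne_top.1 htw) a ha
      have := mul_updTerm_prod_apply (P := P) (lamC := lamC) (L := L) (z := z) (X := X) (a := a)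
        (w := fun i => P'.w i (a i)) (r := fun i => P'.r i (a i)) (f := fun i => P'.f i (a i))
        hfin (expo fun x => L ∅ x * P.lam x)
        (fun i Y hY => (hQX i (a i) Y (hgood Y hY i (a i))).1)
        (fun i Y hY => (hQX i (a i) Y (hgood Y hY i (a i))).2)
      rw [this, globalWeight, div_eq_mul_inv, mul_comm (Finset.prod _ _), mul_assoc]
      rfl
    rw [posterior, hgx, likelihood_mul_density, hev, ENNReal.mul_div_mul_left _ _ hK0 hKtop, hsum,
      ← Finset.mul_sum, div_eq_mul_inv, ENNReal.mul_inv (Or.inl hI0) (Or.inl hItop),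
      ← ENNReal.eq_inv_of_mul_eq_one_left hvI]
    ring

end Posterior

end PMBM

/-! ### The space of trajectories -/

section Trajectories

variable {𝒳 : Type*} [MeasurableSpace 𝒳]

lemma measurableEmbedding_sigma_mk {ι : Type*} {β : ι → Type*} [∀ i, MeasurableSpace (β i)]
    (i : ι) : MeasurableEmbedding (Sigma.mk i : β i → Σ j, β j) where
  injective := sigma_mk_injective
  measurable := by
    intro s hs
    exact MeasurableSpace.measurableSet_iInf.1 hs i
  measurableSet_image' := by
    intro s hs
    refine MeasurableSpace.measurableSet_iInf.2 fun j => ?_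
    change MeasurableSet (Sigma.mk j ⁻¹' (Sigma.mk i '' s))
    by_cases hij : i = j
    · subst hij
      rwa [Set.preimage_image_eq _ sigma_mk_injective]
    · convert MeasurableSet.empty
      ext x
      simp only [Set.mem_preimage, Set.mem_image, Set.mem_empty_iff_false, iff_false]
      rintro ⟨y, _, h⟩
      exact hij (congrArg Sigma.fst h)

instance instMeasurableEqSigma {ι : Type*} [Countable ι] {β : ι → Type*}
    [∀ i, MeasurableSpace (β i)] [∀ i, MeasurableEq (β i)] : MeasurableEq (Σ i, β i) where
  measurableSet_diagonal := by
    have h : Set.diagonal (Σ i, β i) = ⋃ i, Prod.map (Sigma.mk i) (Sigma.mk i) ''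
        Set.diagonal (β i) := by
      ext ⟨p, q⟩
      simp only [Set.mem_diagonal_iff, Set.mem_iUnion, Set.mem_image, Prod.exists, Prod.map_apply,
        Prod.mk.injEq]
      constructor
      · rintro rfl
        exact ⟨p.1, p.2, p.2, rfl, rfl, rfl⟩
      · rintro ⟨i, x, y, rfl, rfl, rfl⟩
        rfl
    rw [h]
    exact MeasurableSet.iUnion fun i => ((measurableEmbedding_sigma_mk i).prodMap
      (measurableEmbedding_sigma_mk i)).measurableSet_image' measurableSet_diagonal

instance instFiniteTrajIdx (k : ℕ) : Finite (TrajIdx k) := by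
  refine Set.Finite.to_subtype (Set.Finite.subset
    ((Set.finite_Iic (k + 1)).prod (Set.finite_Iic (k + 1))) ?_)
  rintro ⟨t, n⟩ ⟨h1, h2, h3⟩
  simp only [Set.mem_prod, Set.mem_Iic] at h1 h2 h3 ⊢
  omega

variable (μ : Measure 𝒳) [SigmaFinite μ] (k : ℕ)

instance instSigmaFiniteTrajMeasure : SigmaFinite (trajMeasure μ k) := by
  have : ∀ p : TrajIdx k, SigmaFinite
      ((Measure.pi fun _ : Fin p.1.2 => μ).map fun x => (⟨p, x⟩ : Traj 𝒳 k)) :=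
    fun p => (measurableEmbedding_sigma_mk
      (β := fun p : TrajIdx k => Fin p.1.2 → 𝒳) p).sigmaFinite_map
  rw [trajMeasure]
  infer_instance

instance instNullSingletonClassTrajMeasure [NullSingletonClass μ] :
    NullSingletonClass (trajMeasure μ k) where
  measure_singleton := by
    rintro ⟨q, y⟩
    rw [trajMeasure, Measure.sum_apply_of_countable, ENNReal.tsum_eq_zero]
    intro p
    refine ((measurableEmbedding_sigma_mk
      (β := fun p : TrajIdx k => Fin p.1.2 → 𝒳) p).map_apply _ _).trans ?_
    -- Trajectories have length at least one; on the one-point space of empty tuples the product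
    -- measure would be a point mass.
    have : Nonempty (Fin p.1.2) := ⟨⟨0, p.2.2.1⟩⟩
    refine Set.Subsingleton.measure_zero (fun a ha b hb => ?_) _
    exact sigma_mk_injective ((Set.mem_singleton_iff.1 ha).trans (Set.mem_singleton_iff.1 hb).symm)

end Trajectories

/-! ### Measurability of set density kernels -/

lemma IsSetDensityKernel.measurable_map {T Z : Type*} [MeasurableSpace Z] [MeasurableSpace T]
    {ν : Measure Z} {L : Finset Z → T → ℝ≥0∞} (hL : IsSetDensityKernel ν L) {m : ℕ}
    (z : Fin m ↪ Z) (s : Finset (Fin m)) : Measurable (L (s.map z)) := by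
  classical
  have h : s.map z = tupleSet fun i => z (s.equivFin.symm i) := by
    ext y
    simp only [tupleSet, Finset.mem_map, Finset.mem_image, Finset.mem_univ, true_and]
    constructor
    · rintro ⟨p, hp, rfl⟩
      exact ⟨s.equivFin ⟨p, hp⟩, by simp⟩
    · rintro ⟨i, rfl⟩
      exact ⟨_, (s.equivFin.symm i).2, rfl⟩
  rw [h]
  exact (hL.measurable s.card).comp (measurable_const.prodMk measurable_id)

/-- The probability of producing no measurement is at most one. -/
lemma IsSetDensityKernel.empty_le_one {T Z : Type*} [MeasurableSpace Z] [MeasurableSpace T]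
    {ν : Measure Z} {L : Finset Z → T → ℝ≥0∞} (hL : IsSetDensityKernel ν L) (x : T) :
    L ∅ x ≤ 1 := by
  rw [← hL.integral_eq_one x, setIntegral]
  refine le_trans ?_ (ENNReal.le_tsum 0)
  simp [tupleSet]

end TrajPMBM

end

theorem proposition2
    {𝒳 : Type*} [TopologicalSpace 𝒳] [LocallyCompactSpace 𝒳] [T2Space 𝒳]
    [SecondCountableTopology 𝒳] [MeasurableSpace 𝒳] [BorelSpace 𝒳]
    (μ : Measure 𝒳) [SigmaFinite μ] [NullSingletonClass μ]
    (k d : ℕ) (form : Formulation)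
    -- measurement density of a single object, and of a single trajectory
    (ℓ : Finset (EuclideanSpace ℝ (Fin d)) → 𝒳 → ℝ≥0∞)
    (hℓ : IsSetDensityKernel volume ℓ)
    (L : Finset (EuclideanSpace ℝ (Fin d)) → Traj 𝒳 k → ℝ≥0∞)
    (hL : IsSetDensityKernel volume L)
    (hLℓ : ∀ w, ∀ X ∈ aliveTraj 𝒳 k, L w X = ℓ w X.last)
    -- clutter intensity
    (lamC : EuclideanSpace ℝ (Fin d) → ℝ≥0∞) (hlamC : Measurable lamC)
    (hlamC_int : ∫⁻ y, lamC y ≠ ∞)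
    -- predicted PMBM density
    (P : PMBM (Traj 𝒳 k)) (g : Finset (Traj 𝒳 k) → ℝ≥0∞)
    (hP : P.Represents (trajMeasure μ k) (form.domain 𝒳 k) k g)
    -- the measurements of time `k`, for which Bayes' rule is meaningful
    (m : ℕ) (z : Fin m ↪ EuclideanSpace ℝ (Fin d))
    (hz_pos : evidence (trajMeasure μ k)
      (multiLikelihood volume lamC L (Finset.univ.map z)) g ≠ 0)
    (hz_fin : evidence (trajMeasure μ k)
      (multiLikelihood volume lamC L (Finset.univ.map z)) g ≠ ∞) :
    (P.update (trajMeasure μ k) lamC L z k).Represents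
        (trajMeasure μ k) (form.domain 𝒳 k) (k + 1)
        (posterior (trajMeasure μ k)
          (multiLikelihood volume lamC L (Finset.univ.map z)) g) ∧
      Nat.card (P.update (trajMeasure μ k) lamC L z k).Comp =
        Nat.card P.Comp + m ∧
      (∀ i : P.Comp,
        Nat.card ((P.update (trajMeasure μ k) lamC L z k).Hyp (Sum.inl i)) =
          2 ^ m * Nat.card (P.Hyp i)) ∧
      (∀ j : Fin m, (newSets j).card = 2 ^ (j : ℕ) ∧
        (∀ s ∈ newSets j, s.Nonempty) ∧
        Nat.card ((P.update (trajMeasure μ k) lamC L z k).Hyp (Sum.inr j)) =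
          2 ^ (j : ℕ) + 1) := by
  refine ⟨PMBM.represents_update volume hP (hL.measurable_map z) hL.empty_le_one hz_pos hz_fin,
    ?_, fun i => ?_, fun j => ⟨card_newSets j, fun s hs => ⟨j, ((mem_newSets j s).1 hs).1⟩, ?_⟩⟩
  · change Nat.card (P.Comp ⊕ Fin m) = _
    rw [Nat.card_sum, Nat.card_eq_fintype_card (α := Fin m), Fintype.card_fin]
  · change Nat.card (P.Hyp i × Finset (Fin m)) = _
    rw [Nat.card_prod, Nat.card_eq_fintype_card (α := Finset (Fin m)), Fintype.card_finset,
      Fintype.card_fin, mul_comm]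
  · change Nat.card (Option {s : Finset (Fin m) // s ∈ newSets j}) = _
    rw [Nat.card_eq_fintype_card, Fintype.card_option, Fintype.card_coe, card_newSets]
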